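/- **Lemma.** Let $(M,h)$ be a connected smooth pseudo-Riemannian manifold (any signature) of dimension $n\ge 3$, with Levi-Civita connection $D$, Ricci curvature $R_{ij}$ and scalar curvature $R_h=h^{ij}R_{ij}$; write $|\omega|_h^2=\omega^{i_1\dots i_k}\omega_{i_1\dots i_k}$ and $\operatorname{div}(\omega)_{i_1\dots i_{k-1}}=D^p\omega_{pi_1\dots i_{k-1}}$. Let $S^k_0(T^*M)$ be the bundle of trace-free completely symmetric covariant $k$-tensors ($S^1_0(T^*M)=T^*M$). For $\omega\in\Gamma(S^k_0(T^*M))$, $k\ge1$, let $$K(\omega)_{iji_1\dots i_{k-1}}=D_{[i}\omega_{j]i_1\dots i_{k-1}}-\tfrac{1}{n+k-3}\sum_{s=1}^{k-1}h_{i_s[i}\operatorname{div}(\omega)_{j]i_1\dots\hat{i}_s\dots i_{k-1}},$$ $$L(\omega)_{i_1\dots i_{k+1}}=D_{(i_1}\omega_{i_2\dots i_{k+1})}-\tfrac{k}{n+2(k-1)}h_{(i_1i_2}\operatorname{div}(\omega)_{i_3\dots i_{k+1})}$$ be the trace-free Codazzi and conformal Killing operators, and define the Codazzi pairing, conformal Killing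 pairing and divergence pairing one-forms by $\omega^{p_1\dots p_k}K(\omega)_{ip_1\dots p_k}$, $\omega^{p_1\dots p_k}L(\omega)_{ip_1\dots p_k}$ and $\omega_i{}^{p_1\dots p_{k-1}}\operatorname{div}(\omega)_{p_1\dots p_{k-1}}$. For $k\ge2$ let $(\omega\wedge\omega)_{ijkl}=\omega_{k[i}{}^{P}\omega_{j]lP}-\omega_{l[i}{}^{P}\omega_{j]kP}$ ($P=p_1\dots p_{k-2}$) and let $\rho(\omega)_{ij}=h^{pq}(\omega\wedge\omega)_{pijq}$ be its Ricci trace; for $k=1$ let $\rho(\omega)_{ij}=\omega_i\omega_j$. Put $$T^+(\omega)=\rho(\omega)-\tfrac12|\omega|_h^2h,\qquad T^-(\omega)=\rho(\omega)+\tfrac1{2k}|\omega|_h^2h .$$ For each $k\ge1$ let $\omega^{(k)},\gamma^{(k)}\in\Gamma(S^k_0(T^*M))$ and $a_k,b_k\in\mathbb R$. Suppose that the divergence pairing and Codazzi pairing one-forms of every $\omega^{(k)}$ vanish, that the divergence pairing and conformal Killing pairing one-forms of every $\gamma^{(k)}$ vanish, and that the series $\sum_{k\ge1}a_kT^+(\omega^{(k)})$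 and $\sum_{k\ge1}b_kT^-(\gamma^{(k)})$ converge pointwise (as limits of partial sums) to smooth sections $\mathcal S$ and $\mathcal T$ of $S^2(T^*M)$. For a function $\kappa:M\to\mathbb R$ consider the Einstein equations $$R_{ij}-\tfrac12R_hh_{ij}+\tfrac{n-2}{2n}\kappa h_{ij}=\mathcal S_{ij}+\mathcal T_{ij}.\tag{1}$$ Then: 1. $\mathcal S$ and $\mathcal T$ are divergence free. The equations (1) are consistent with $\kappa$ constant: for smooth $\kappa$, the divergences of the two sides of (1) agree if and only if $\kappa$ is constant. 2. If (1) holds for some function $\kappa$, then $\kappa$ is constant and $$\kappa=R_h-\sum_{k\ge1}a_k|\omega^{(k)}|_h^2+\sum_{k\ge1}\tfrac{n+2k}{k(n-2)}b_k|\gamma^{(k)}|_h^2 .\tag{2}$$ 3. For every function $\kappa$, (1) holds if and only if $$R_{ij}-\sum_{k\ge1}a_k\rho(\omega^{(k)})_{ij}-\sum_{k\ge1}b_k\rho(\gamma^{(k)})_{ij}=\Big(\tfrac{\kappa}{n}-\tfrac1{n-2}\sum_{k\ge1}\tfrac{k+1}{k}b_k|\gamma^{(k)}|_h^2\Big)h_{ij}.$$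 4. There is a real constant $\kappa$ for which (1) holds if and only if the trace-free Ricci condition holds, that is, there is a function $\mu:M\to\mathbb R$ with $$R_{ij}-\sum_{k\ge1}a_k\rho(\omega^{(k)})_{ij}-\sum_{k\ge1}b_k\rho(\gamma^{(k)})_{ij}=\mu h_{ij}.$$ All series in 2, 3 and 4 converge pointwise. -/

import Mathlib

open scoped Manifold ContDiff

namespace CoupledEinstein

noncomputable section

/-! ### Tensor calculus in a coordinate chart

Inside a chart a metric is a function `g : ℝⁿ → Matrix`, `g y i j = h_{ij}(y)`, and a covariant
tensor of rank `k` is a function `w : ℝⁿ → (Fin k → Fin n) → ℝ`,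
`w y I = ω_{I 0, …, I (k-1)}(y)`. -/

/-- The coordinate space `ℝⁿ`. -/
abbrev Coord (n : ℕ) : Type := EuclideanSpace ℝ (Fin n)

/-- Components, in a chart, of a covariant tensor field of rank `k`. -/
abbrev Comp (n k : ℕ) : Type := Coord n → (Fin k → Fin n) → ℝ

/-- Components, in a chart, of a covariant tensor field of rank two. -/
abbrev Comp2 (n : ℕ) : Type := Coord n → Matrix (Fin n) (Fin n) ℝ

variable {n : ℕ}

/-- The partial derivative `∂_i f`. -/
def pd (i : Fin n) (f : Coord n → ℝ) (y : Coord n) : ℝ :=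
  fderiv ℝ f y (EuclideanSpace.single i 1)

/-- The Christoffel symbol `Γ^p_{ij}` of the Levi-Civita connection of `g`. -/
def christoffel (g : Comp2 n) (p i j : Fin n) (y : Coord n) : ℝ :=
  (1 / 2) * ∑ q, (g y)⁻¹ p q *
    (pd i (fun z => g z j q) y + pd j (fun z => g z i q) y - pd q (fun z => g z i j) y)

/-- The curvature `R_{ijk}^l` of the Levi-Civita connection `D` of `g`, normalized by
`D_i D_j α_k - D_j D_i α_k = - R_{ijk}^l α_l`. -/
def riemann (g : Comp2 n) (i j k l : Fin n) (y : Coord n) : ℝ :=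
  pd i (christoffel g l j k) y - pd j (christoffel g l i k) y
    + ∑ p, (christoffel g l i p y * christoffel g p j k y
        - christoffel g l j p y * christoffel g p i k y)

/-- The Ricci curvature `R_{ij} = R_{pij}^p`. -/
def ricci (g : Comp2 n) : Comp2 n := fun y => Matrix.of fun i j => ∑ p, riemann g p i j p y

/-- The trace `h^{ij} s_{ij}` of a rank two tensor. -/
def trace2 (g s : Comp2 n) (y : Coord n) : ℝ := ∑ i, ∑ j, (g y)⁻¹ i j * s y i j

/-- The scalar curvature `h^{ij} R_{ij}`. -/
def scal (g : Comp2 n) (y : Coord n) : ℝ := trace2 g (ricci g) y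

/-- The covariant derivative `D_i ω_I`. -/
def covD {k : ℕ} (g : Comp2 n) (w : Comp n k) (i : Fin n) (I : Fin k → Fin n)
    (y : Coord n) : ℝ :=
  pd i (fun z => w z I) y
    - ∑ s, ∑ p, christoffel g p i (I s) y * w y (Function.update I s p)

/-- The divergence `div(ω)_I = D^p ω_{p I} = h^{pq} D_q ω_{p I}`. -/
def divg {k : ℕ} (g : Comp2 n) (w : Comp n (k + 1)) : Comp n k :=
  fun y I => ∑ p, ∑ q, (g y)⁻¹ p q * covD g w q (Fin.cons p I : Fin (k + 1) → Fin n) y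

/-- The divergence `D^p s_{pj}` of a rank two tensor. -/
def div2 (g s : Comp2 n) (j : Fin n) (y : Coord n) : ℝ :=
  divg g (fun z (I : Fin 2 → Fin n) => s z (I 0) (I 1)) y (fun _ => j)

/-- The complete contraction `A^I B_I = h^{i₁ j₁} ⋯ h^{i_k j_k} A_{i₁ … i_k} B_{j₁ … j_k}` at a
point, where `G` is the matrix `h^{ij}` of the inverse metric at that point. -/
def contract {k : ℕ} (G : Matrix (Fin n) (Fin n) ℝ) (A B : (Fin k → Fin n) → ℝ) : ℝ :=
  ∑ I, ∑ J, (∏ s, G (I s) (J s)) * A I * B J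

/-- `|ω|²_h = ω^{i₁ … i_k} ω_{i₁ … i_k}`. -/
def normSq {k : ℕ} (g : Comp2 n) (w : Comp n k) (y : Coord n) : ℝ :=
  contract (g y)⁻¹ (w y) (w y)

/-- The trace `h^{pq} ω_{p q I}`. -/
def tr {k : ℕ} (g : Comp2 n) (w : Comp n (k + 2)) : Comp n k :=
  fun y I => ∑ p, ∑ q, (g y)⁻¹ p q *
    w y (Fin.cons p (Fin.cons q I : Fin (k + 1) → Fin n) : Fin (k + 2) → Fin n)

/-- The symmetrization `T_{(i₁ … i_r)}`. -/
def symmetrize {r : ℕ} (T : (Fin r → Fin n) → ℝ) (I : Fin r → Fin n) : ℝ :=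
  (1 / (r.factorial : ℝ)) * ∑ σ : Equiv.Perm (Fin r), T (fun s => I (σ s))

/-- The Codazzi operator on trace-free symmetric tensors of rank `k = m + 1`:
`K(ω)_{ij i₁ … i_{k-1}} = D_{[i} ω_{j] i₁ … i_{k-1}}
  - (n+k-3)⁻¹ ∑_s h_{i_s [i} div(ω)_{j] i₁ … î_s … i_{k-1}}`.
As `div(ω)` is symmetric, `div(ω)_{j i₁ … î_s … i_{k-1}}` is the component of `div(ω)` at the
multi-index `I` with `I s` replaced by `j`. For `k = 1` the sum is empty. -/
def codazzi {m : ℕ} (g : Comp2 n) (w : Comp n (m + 1)) (i j : Fin n) (I : Fin m → Fin n)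
    (y : Coord n) : ℝ :=
  (1 / 2) * (covD g w i (Fin.cons j I : Fin (m + 1) → Fin n) y
      - covD g w j (Fin.cons i I : Fin (m + 1) → Fin n) y)
    - (1 / ((n : ℝ) + ((m : ℝ) + 1) - 3)) * ∑ s,
        (1 / 2) * (g y (I s) i * divg g w y (Function.update I s j)
          - g y (I s) j * divg g w y (Function.update I s i))

/-- The conformal Killing operator on trace-free symmetric tensors of rank `k = m + 1`:
`L(ω)_{i₁ … i_{k+1}} = D_{(i₁} ω_{i₂ … i_{k+1})}
  - k (n+2(k-1))⁻¹ h_{(i₁ i₂} div(ω)_{i₃ … i_{k+1})}`. -/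
def confKilling {m : ℕ} (g : Comp2 n) (w : Comp n (m + 1)) (I : Fin (m + 2) → Fin n)
    (y : Coord n) : ℝ :=
  symmetrize (fun J : Fin (m + 2) → Fin n =>
    covD g w (J 0) (Fin.tail J) y
      - (((m : ℝ) + 1) / ((n : ℝ) + 2 * (m : ℝ))) *
        (g y (J 0) (J 1) * divg g w y (Fin.tail (Fin.tail J)))) I

/-- The Codazzi pairing one-form `ω^{p₁ … p_k} K(ω)_{i p₁ … p_k}`. -/
def codazziPairing {m : ℕ} (g : Comp2 n) (w : Comp n (m + 1)) (i : Fin n) (y : Coord n) : ℝ :=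
  contract (g y)⁻¹ (w y) (fun P : Fin (m + 1) → Fin n => codazzi g w i (P 0) (Fin.tail P) y)

/-- The conformal Killing pairing one-form `ω^{p₁ … p_k} L(ω)_{i p₁ … p_k}`. -/
def confKillingPairing {m : ℕ} (g : Comp2 n) (w : Comp n (m + 1)) (i : Fin n)
    (y : Coord n) : ℝ :=
  contract (g y)⁻¹ (w y)
    (fun P : Fin (m + 1) → Fin n => confKilling g w (Fin.cons i P : Fin (m + 2) → Fin n) y)

/-- The divergence pairing one-form `ω_i^{p₁ … p_{k-1}} div(ω)_{p₁ … p_{k-1}}`. -/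
def divPairing {m : ℕ} (g : Comp2 n) (w : Comp n (m + 1)) (i : Fin n) (y : Coord n) : ℝ :=
  contract (g y)⁻¹ (fun P : Fin m → Fin n => w y (Fin.cons i P : Fin (m + 1) → Fin n))
    (divg g w y)

/-- `(α ∧ β)_{ijkl} = α_{k[i}^P β_{j]lP} - α_{l[i}^P β_{j]kP}`, the Kulkarni–Nomizu type product
of symmetric tensors of rank `r + 2`. -/
def kwedge {r : ℕ} (g : Comp2 n) (α β : Comp n (r + 2)) (i j k l : Fin n) (y : Coord n) : ℝ :=
  let c : Fin n → Fin n → Fin n → Fin n → ℝ := fun a b a' b' =>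
    contract (g y)⁻¹
      (fun P : Fin r → Fin n =>
        α y (Fin.cons a (Fin.cons b P : Fin (r + 1) → Fin n) : Fin (r + 2) → Fin n))
      (fun P : Fin r → Fin n =>
        β y (Fin.cons a' (Fin.cons b' P : Fin (r + 1) → Fin n) : Fin (r + 2) → Fin n))
  (1 / 2) * (c k i j l - c k j i l) - (1 / 2) * (c l i j k - c l j i k)

/-- For a tensor of rank `k ≥ 2`, the Ricci trace `h^{pq} (ω ∧ ω)_{pijq}` of `ω ∧ ω`; for a
one-form, `ω_i ω_j`. -/
def ricWedge (g : Comp2 n) : {m : ℕ} → Comp n (m + 1) → Comp2 n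
  | 0, w => fun y => Matrix.of fun i j => w y (fun _ => i) * w y (fun _ => j)
  | _ + 1, w => fun y => Matrix.of fun i j => ∑ p, ∑ q, (g y)⁻¹ p q * kwedge g w w p i j q y

/-- `T⁺(ω) = Ric(ω ∧ ω) - (1/2) |ω|² h`. -/
def stressPlus {m : ℕ} (g : Comp2 n) (w : Comp n (m + 1)) : Comp2 n := fun y =>
  ricWedge g w y - ((1 / 2) * normSq g w y) • g y

/-- `T⁻(ω) = Ric(ω ∧ ω) + (1/(2k)) |ω|² h` for `ω` of rank `k = m + 1`. -/
def stressMinus {m : ℕ} (g : Comp2 n) (w : Comp n (m + 1)) : Comp2 n := fun y =>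
  ricWedge g w y + ((1 / (2 * ((m : ℝ) + 1))) * normSq g w y) • g y

/-- `R_{ij} - (1/2) R h_{ij} + ((n-2)/(2n)) κ h_{ij}` for a function `κ`. -/
def einsteinTensor (g : Comp2 n) (κ : Coord n → ℝ) : Comp2 n := fun y =>
  ricci g y - ((1 / 2) * scal g y) • g y + ((((n : ℝ) - 2) / (2 * (n : ℝ))) * κ y) • g y

/-! ### Tensor fields on a manifold -/

variable {M : Type*} [TopologicalSpace M] [ChartedSpace (Coord n) M]

/-- `e` is a smooth coordinate chart of `M`. -/
def IsChart (e : OpenPartialHomeomorph M (Coord n)) : Prop :=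
  e ∈ IsManifold.maximalAtlas (𝓡 n) ∞ M

/-- The coordinate vector `∂_i` of the chart `e` at the point with coordinates `y`. -/
def coordVec (e : OpenPartialHomeomorph M (Coord n)) (y : Coord n) (i : Fin n) :
    TangentSpace (𝓡 n) (e.symm y) :=
  mfderiv (𝓡 n) (𝓡 n) e.symm y (EuclideanSpace.single i (1 : ℝ) : Coord n)

variable (n M)

/-- A smooth section of `S²(T*M)`. -/
structure SymTwoTensorField where
  toFun : ∀ x : M, LinearMap.BilinForm ℝ (TangentSpace (𝓡 n) x)
  symm : ∀ (x : M) (u v : TangentSpace (𝓡 n) x), toFun x u v = toFun x v u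
  smooth : ∀ e : OpenPartialHomeomorph M (Coord n), IsChart e → ∀ i j : Fin n,
    ContDiffOn ℝ ∞ (fun y => toFun (e.symm y) (coordVec e y i) (coordVec e y j)) e.target

/-- A smooth pseudo-Riemannian metric on `M`, of any signature. -/
structure PseudoRiemannianMetric extends SymTwoTensorField n M where
  nondegenerate : ∀ (x : M) (u : TangentSpace (𝓡 n) x), (∀ v, toFun x u v = 0) → u = 0

/-- A smooth section of `S^k(T*M)`. -/
structure SymTensorField (k : ℕ) where
  toFun : ∀ x : M, MultilinearMap ℝ (fun _ : Fin k => TangentSpace (𝓡 n) x) ℝ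
  symm : ∀ (x : M) (σ : Equiv.Perm (Fin k)) (v : Fin k → TangentSpace (𝓡 n) x),
    toFun x (fun s => v (σ s)) = toFun x v
  smooth : ∀ e : OpenPartialHomeomorph M (Coord n), IsChart e → ∀ I : Fin k → Fin n,
    ContDiffOn ℝ ∞ (fun y => toFun (e.symm y) (fun s => coordVec e y (I s))) e.target

variable {n M}

/-- The components of a rank two tensor field in the chart `e`. -/
def SymTwoTensorField.comp (S : SymTwoTensorField n M)
    (e : OpenPartialHomeomorph M (Coord n)) : Comp2 n := fun y =>
  Matrix.of fun i j => S.toFun (e.symm y) (coordVec e y i) (coordVec e y j)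

/-- The components of the metric in the chart `e`. -/
def PseudoRiemannianMetric.comp (h : PseudoRiemannianMetric n M)
    (e : OpenPartialHomeomorph M (Coord n)) : Comp2 n :=
  h.toSymTwoTensorField.comp e

/-- The components of a rank `k` tensor field in the chart `e`. -/
def SymTensorField.comp {k : ℕ} (w : SymTensorField n M k)
    (e : OpenPartialHomeomorph M (Coord n)) : Comp n k := fun y I =>
  w.toFun (e.symm y) (fun s => coordVec e y (I s))

/-- `w` is a section of `S^k_0(T*M)`: its trace vanishes. Tensors of rank at most one are
trace-free by convention. -/
def SymTensorField.IsTraceFree (h : PseudoRiemannianMetric n M) :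
    {k : ℕ} → SymTensorField n M k → Prop
  | 0, _ => True
  | 1, _ => True
  | _ + 2, w => ∀ e : OpenPartialHomeomorph M (Coord n), IsChart e → ∀ y ∈ e.target, ∀ I,
      tr (h.comp e) (w.comp e) y I = 0

/-- The Codazzi pairing one-form of `w` vanishes. -/
def SymTensorField.CodazziPairingZero {m : ℕ} (h : PseudoRiemannianMetric n M)
    (w : SymTensorField n M (m + 1)) : Prop :=
  ∀ e : OpenPartialHomeomorph M (Coord n), IsChart e → ∀ y ∈ e.target, ∀ i,
    codazziPairing (h.comp e) (w.comp e) i y = 0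

/-- The conformal Killing pairing one-form of `w` vanishes. -/
def SymTensorField.ConfKillingPairingZero {m : ℕ} (h : PseudoRiemannianMetric n M)
    (w : SymTensorField n M (m + 1)) : Prop :=
  ∀ e : OpenPartialHomeomorph M (Coord n), IsChart e → ∀ y ∈ e.target, ∀ i,
    confKillingPairing (h.comp e) (w.comp e) i y = 0

/-- The divergence pairing one-form of `w` vanishes. -/
def SymTensorField.DivPairingZero {m : ℕ} (h : PseudoRiemannianMetric n M)
    (w : SymTensorField n M (m + 1)) : Prop :=
  ∀ e : OpenPartialHomeomorph M (Coord n), IsChart e → ∀ y ∈ e.target, ∀ i,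
    divPairing (h.comp e) (w.comp e) i y = 0

/-- `S` is divergence free. -/
def SymTwoTensorField.IsDivFree (h : PseudoRiemannianMetric n M)
    (S : SymTwoTensorField n M) : Prop :=
  ∀ e : OpenPartialHomeomorph M (Coord n), IsChart e → ∀ y ∈ e.target, ∀ j,
    div2 (h.comp e) (S.comp e) j y = 0

/-- The Einstein equations `R_{ij} - (1/2) R h_{ij} + ((n-2)/(2n)) κ h_{ij} = S_{ij} + T_{ij}`. -/
def SolvesEinstein (h : PseudoRiemannianMetric n M) (S T : SymTwoTensorField n M)
    (κ : M → ℝ) : Prop :=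
  ∀ e : OpenPartialHomeomorph M (Coord n), IsChart e → ∀ y ∈ e.target,
    einsteinTensor (h.comp e) (fun z => κ (e.symm z)) y = S.comp e y + T.comp e y

/-- The two sides of the Einstein equations with the function `κ` have the same divergence. -/
def EinsteinDivergenceCompatible (h : PseudoRiemannianMetric n M) (S T : SymTwoTensorField n M)
    (κ : M → ℝ) : Prop :=
  ∀ e : OpenPartialHomeomorph M (Coord n), IsChart e → ∀ y ∈ e.target, ∀ j,
    div2 (h.comp e) (einsteinTensor (h.comp e) (fun z => κ (e.symm z))) j y
      = div2 (h.comp e) (fun z => S.comp e z + T.comp e z) j y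

/-- The sum `∑_{m = 0}^∞ f m`, as the limit of its partial sums in their natural order. -/
def seriesSum (f : ℕ → ℝ) : ℝ := ∑'[SummationFilter.conditional ℕ] m, f m

/-- The series `∑_{m = 0}^∞ f m` converges, possibly conditionally. -/
def SeriesConverges (f : ℕ → ℝ) : Prop := Summable f (SummationFilter.conditional ℕ)

/-- The series `∑_{m = 0}^∞ f m` converges to `s`, possibly conditionally. -/
def SeriesHasSum (f : ℕ → ℝ) (s : ℝ) : Prop := HasSum f s (SummationFilter.conditional ℕ)

/-- The component
`R_{ij} - ∑_k a_k Ric(ω^{(k)} ∧ ω^{(k)})_{ij} - ∑_k b_k Ric(γ^{(k)} ∧ γ^{(k)})_{ij}`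
at coordinates `y` in the chart `e`, where the terms with `k = 1` are `a₁ ω_i ω_j` and
`b₁ γ_i γ_j`. -/
def reducedRicci (h : PseudoRiemannianMetric n M) (w γ : ∀ m : ℕ, SymTensorField n M (m + 1))
    (a b : ℕ → ℝ) (e : OpenPartialHomeomorph M (Coord n)) (y : Coord n) (i j : Fin n) : ℝ :=
  ricci (h.comp e) y i j
    - seriesSum (fun m => a m * ricWedge (h.comp e) ((w m).comp e) y i j)
    - seriesSum (fun m => b m * ricWedge (h.comp e) ((γ m).comp e) y i j)

end

end CoupledEinstein

open CoupledEinstein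

/-! The divergence of each stress tensor is governed by two one-forms, `d|ω|²` and the transport
term `ω^{pP} D_p ω_{jP}`. For trace-free symmetric `ω` the Ricci trace collapses to `ρ(ω)_{ij} =
ω_i^P ω_{jP}` (`ricWedge_eq`), and the Leibniz rule splits its divergence into the divergence
pairing plus the transport term. When the divergence pairing vanishes, the metric corrections in `K`
and `L` contract to zero against `ω`, so the Codazzi pairing is `(1/4) d|ω|²` minus half the
transport term, and the conformal Killing pairing is `(k+1)⁻¹` times `(1/2) d|ω|²` plus `k` times
the transport term. Their vanishing gives transport `= (1/2) d|ω|²`, respectively `-(1/(2k)) d|ω|²`,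
which is what `T⁺` and `T⁻` need to be divergence free.

The series converge only pointwise, so they cannot be differentiated term by term.
`firstOrder_eq_zero_of_tendsto` replaces this by a Baire argument: if the divergence of the limit
were nonzero somewhere, it would be nonzero on an open set, inside which the partial sums are
uniformly bounded on a smaller open set; there dominated convergence in the weak form of the
equation makes the divergence vanish almost everywhere.

The contracted Bianchi identity reduces the divergence of the left side of the Einstein equations to
`((n-2)/(2n)) dκ`. The trace of the equations expresses `κ` by smooth quantities, so a `κ` with no
assumed regularity is smooth, hence constant by connectedness.

The separate series are recovered from traces. The trace of `T⁺` is `(1 - n/2)|ω|²`; that of `T⁻` is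
`((n+2k)/(2k))|γ|²`, and Dirichlet's test with weights `2/(n+2k)` yields first `∑ b_k|γ|²/k`, then
`∑ b_k|γ|²`. The Einstein and Ricci forms of the equations have the same trace-free part and the
same trace formula for `κ`, so they are equivalent pointwise. Given only a pure-trace Ricci
condition with factor `μ`, one solves for `κ` as a function and then learns that it is constant. -/

namespace CoupledEinstein

noncomputable section

/-! ### Partial derivatives -/

section PartialDerivatives

variable {n : ℕ} {f g : Coord n → ℝ} {y : Coord n} {U : Set (Coord n)}

lemma pd_add (i : Fin n) (hf : DifferentiableAt ℝ f y) (hg : DifferentiableAt ℝ g y) :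
    pd i (fun z => f z + g z) y = pd i f y + pd i g y := by
  simp only [pd, fderiv_fun_add hf hg, _root_.add_apply]

lemma pd_sub (i : Fin n) (hf : DifferentiableAt ℝ f y) (hg : DifferentiableAt ℝ g y) :
    pd i (fun z => f z - g z) y = pd i f y - pd i g y := by
  simp only [pd, fderiv_fun_sub hf hg, _root_.sub_apply]

lemma pd_mul (i : Fin n) (hf : DifferentiableAt ℝ f y) (hg : DifferentiableAt ℝ g y) :
    pd i (fun z => f z * g z) y = pd i f y * g y + f y * pd i g y := by
  simp only [pd, fderiv_fun_mul hf hg, _root_.add_apply,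
    _root_.smul_apply, smul_eq_mul]
  ring

lemma pd_const (i : Fin n) (c : ℝ) (y : Coord n) : pd i (fun _ => c) y = 0 := by
  simp [pd]

lemma pd_const_mul (i : Fin n) (c : ℝ) (hf : DifferentiableAt ℝ f y) :
    pd i (fun z => c * f z) y = c * pd i f y := by
  rw [pd_mul i (differentiableAt_const c) hf, pd_const]
  ring

lemma pd_sum {ι : Type*} (i : Fin n) (s : Finset ι) {F : ι → Coord n → ℝ}
    (hF : ∀ a ∈ s, DifferentiableAt ℝ (F a) y) :
    pd i (fun z => ∑ a ∈ s, F a z) y = ∑ a ∈ s, pd i (F a) y := by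
  simp only [pd, fderiv_fun_sum hF, _root_.sum_apply]

lemma pd_congr (i : Fin n) (hU : IsOpen U) (hy : y ∈ U) (h : ∀ z ∈ U, f z = g z) :
    pd i f y = pd i g y := by
  have : f =ᶠ[nhds y] g := Filter.eventuallyEq_of_mem (hU.mem_nhds hy) h
  simp only [pd, this.fderiv_eq]

lemma diffAt_of_smooth (hU : IsOpen U) (hf : ContDiffOn ℝ ∞ f U) (hy : y ∈ U) :
    DifferentiableAt ℝ f y :=
  (hf.contDiffAt (hU.mem_nhds hy)).differentiableAt (by simp)

lemma smooth_pd (i : Fin n) (hU : IsOpen U) (hf : ContDiffOn ℝ ∞ f U) :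
    ContDiffOn ℝ ∞ (pd i f) U :=
  (hf.fderiv_of_isOpen hU (m := ∞) (by simp)).clm_apply contDiffOn_const

lemma pd_comm (i j : Fin n) (hU : IsOpen U) (hf : ContDiffOn ℝ ∞ f U) (hy : y ∈ U) :
    pd i (pd j f) y = pd j (pd i f) y := by
  have hf' : DifferentiableAt ℝ (fderiv ℝ f) y :=
    ((hf.fderiv_of_isOpen hU (m := ∞) (by simp)).contDiffAt (hU.mem_nhds hy)).differentiableAt
      (by simp)
  have hs : IsSymmSndFDerivAt ℝ f y :=
    (hf.contDiffAt (hU.mem_nhds hy)).isSymmSndFDerivAt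
      (by simpa using WithTop.coe_le_coe.2 (le_top : (2 : ℕ∞) ≤ ⊤))
  have key : ∀ a b : Fin n, pd a (pd b f) y
      = fderiv ℝ (fderiv ℝ f) y (EuclideanSpace.single a 1) (EuclideanSpace.single b 1) := by
    intro a b
    have h : pd b f = fun z => fderiv ℝ f z (EuclideanSpace.single b 1) := rfl
    rw [pd, h, fderiv_clm_apply hf' (differentiableAt_const _)]
    simp
  rw [key, key, hs.eq]

lemma fderiv_eq_zero_of_pd (h : ∀ i, pd i f y = 0) : fderiv ℝ f y = 0 := by
  apply ContinuousLinearMap.coe_injective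
  refine (EuclideanSpace.basisFun (Fin n) ℝ).toBasis.ext fun i => ?_
  simpa [pd] using h i

end PartialDerivatives

/-! ### Partial derivatives of matrix functions -/

section MatrixDerivatives

variable {n : ℕ} {X Y : Comp2 n} {y : Coord n} {U : Set (Coord n)}

/-- The entrywise partial derivative of a matrix function. -/
def pdMat (m : Fin n) (X : Comp2 n) : Comp2 n := fun y =>
  Matrix.of fun i j => pd m (fun z => X z i j) y

/-- The entries of `X` are smooth on `U`. -/
def SmoothMat (X : Comp2 n) (U : Set (Coord n)) : Prop :=
  ∀ i j, ContDiffOn ℝ ∞ (fun y => X y i j) U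

lemma SmoothMat.pdMat (m : Fin n) (hU : IsOpen U) (hX : SmoothMat X U) :
    SmoothMat (pdMat m X) U := fun i j => smooth_pd m hU (hX i j)

lemma SmoothMat.mul (hX : SmoothMat X U) (hY : SmoothMat Y U) :
    SmoothMat (fun z => X z * Y z) U := fun i j => by
  simp only [Matrix.mul_apply]
  exact ContDiffOn.sum fun k _ => (hX i k).mul (hY k j)

lemma SmoothMat.add (hX : SmoothMat X U) (hY : SmoothMat Y U) :
    SmoothMat (fun z => X z + Y z) U := fun i j => (hX i j).add (hY i j)

lemma SmoothMat.sub (hX : SmoothMat X U) (hY : SmoothMat Y U) :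
    SmoothMat (fun z => X z - Y z) U := fun i j => (hX i j).sub (hY i j)

lemma SmoothMat.transpose (hX : SmoothMat X U) :
    SmoothMat (fun z => (X z).transpose) U := fun i j => hX j i

lemma SmoothMat.smul {f : Coord n → ℝ} (hf : ContDiffOn ℝ ∞ f U) (hX : SmoothMat X U) :
    SmoothMat (fun z => f z • X z) U := fun i j => hf.mul (hX i j)

lemma pdMat_congr (m : Fin n) (hU : IsOpen U) (hy : y ∈ U) (h : ∀ z ∈ U, X z = Y z) :
    pdMat m X y = pdMat m Y y := by
  ext i j
  exact pd_congr m hU hy fun z hz => by rw [h z hz]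

lemma pdMat_const (m : Fin n) (A : Matrix (Fin n) (Fin n) ℝ) (y : Coord n) :
    pdMat m (fun _ => A) y = 0 := by
  ext i j
  exact pd_const m _ y

lemma pdMat_transpose (m : Fin n) (X : Comp2 n) (y : Coord n) :
    pdMat m (fun z => (X z).transpose) y = (pdMat m X y).transpose := rfl

lemma pdMat_add (m : Fin n) (hU : IsOpen U) (hX : SmoothMat X U) (hY : SmoothMat Y U)
    (hy : y ∈ U) : pdMat m (fun z => X z + Y z) y = pdMat m X y + pdMat m Y y := by
  ext i j
  exact pd_add m (diffAt_of_smooth hU (hX i j) hy) (diffAt_of_smooth hU (hY i j) hy)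

lemma pdMat_sub (m : Fin n) (hU : IsOpen U) (hX : SmoothMat X U) (hY : SmoothMat Y U)
    (hy : y ∈ U) : pdMat m (fun z => X z - Y z) y = pdMat m X y - pdMat m Y y := by
  ext i j
  exact pd_sub m (diffAt_of_smooth hU (hX i j) hy) (diffAt_of_smooth hU (hY i j) hy)

lemma pdMat_mul (m : Fin n) (hU : IsOpen U) (hX : SmoothMat X U) (hY : SmoothMat Y U)
    (hy : y ∈ U) :
    pdMat m (fun z => X z * Y z) y = pdMat m X y * Y y + X y * pdMat m Y y := by
  have hX' := fun i j => diffAt_of_smooth hU (hX i j) hy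
  have hY' := fun i j => diffAt_of_smooth hU (hY i j) hy
  ext i j
  simp only [pdMat, Matrix.of_apply, Matrix.mul_apply, Matrix.add_apply]
  rw [pd_sum m Finset.univ (F := fun k z => X z i k * Y z k j)
    fun k _ => (hX' i k).mul (hY' k j), ← Finset.sum_add_distrib]
  exact Finset.sum_congr rfl fun k _ => pd_mul m (hX' i k) (hY' k j)

lemma pdMat_comm (i j : Fin n) (hU : IsOpen U) (hX : SmoothMat X U) (hy : y ∈ U) :
    pdMat i (pdMat j X) y = pdMat j (pdMat i X) y := by
  ext a b
  exact pd_comm i j hU (hX a b) hy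

lemma pd_trace (m : Fin n) (hU : IsOpen U) (hX : SmoothMat X U) (hy : y ∈ U) :
    pd m (fun z => (X z).trace) y = (pdMat m X y).trace :=
  pd_sum m _ fun k _ => diffAt_of_smooth hU (hX k k) hy

lemma smooth_det (hX : SmoothMat X U) : ContDiffOn ℝ ∞ (fun z => (X z).det) U := by
  simp only [Matrix.det_apply']
  exact ContDiffOn.sum fun σ _ => contDiffOn_const.mul (contDiffOn_prod fun k _ => hX _ _)

/-- Cramer's rule: the entries are cofactors, polynomial in the entries of `X`, divided by the
determinant. -/
lemma SmoothMat.inv (hX : SmoothMat X U) (hdet : ∀ y ∈ U, (X y).det ≠ 0) :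
    SmoothMat (fun z => (X z)⁻¹) U := fun i j => by
  have hadj : ContDiffOn ℝ ∞ (fun z => (X z).adjugate i j) U := by
    simp only [Matrix.adjugate_apply]
    refine smooth_det (X := fun z => (X z).updateRow j (Pi.single i 1)) fun a b => ?_
    by_cases h : a = j
    · subst h; simpa using contDiffOn_const
    · simpa [Matrix.updateRow_ne h] using hX a b
  refine (((smooth_det hX).inv hdet).mul hadj).congr fun z _ => ?_
  simp [Matrix.inv_def]

end MatrixDerivatives

/-! ### Metrics on open subsets of the coordinate space -/

/-- `g` is a pseudo-Riemannian metric on the open set `U`. -/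
structure IsMetricOn {n : ℕ} (g : Comp2 n) (U : Set (Coord n)) : Prop where
  isOpen : IsOpen U
  symm : ∀ y, (g y).transpose = g y
  smooth : SmoothMat g U
  det_ne_zero : ∀ y ∈ U, (g y).det ≠ 0

section Metric

variable {n : ℕ} {g : Comp2 n} {y : Coord n} {U : Set (Coord n)}

/-- The matrix `(Γ^l_{ik})_{l,k}` of the Levi-Civita connection in the direction `∂_i`. -/
def conn (g : Comp2 n) (i : Fin n) : Comp2 n := fun y =>
  Matrix.of fun l k => christoffel g l i k y

/-- Valid off `U` as well, so component functions can be interchanged before they are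
differentiated. -/
lemma IsMetricOn.apply_symm (hg : IsMetricOn g U) (y : Coord n) (i j : Fin n) :
    g y i j = g y j i := by
  conv_lhs => rw [← hg.symm y]
  rfl

lemma IsMetricOn.inv_transpose (hg : IsMetricOn g U) (y : Coord n) :
    (g y)⁻¹.transpose = (g y)⁻¹ := by
  rw [Matrix.transpose_nonsing_inv, hg.symm]

lemma IsMetricOn.inv_apply_symm (hg : IsMetricOn g U) (y : Coord n) (i j : Fin n) :
    (g y)⁻¹ i j = (g y)⁻¹ j i := by
  conv_lhs => rw [← hg.inv_transpose y]
  rfl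

lemma IsMetricOn.mul_inv (hg : IsMetricOn g U) (hy : y ∈ U) : g y * (g y)⁻¹ = 1 :=
  Matrix.mul_nonsing_inv _ (hg.det_ne_zero y hy).isUnit

lemma IsMetricOn.inv_mul (hg : IsMetricOn g U) (hy : y ∈ U) : (g y)⁻¹ * g y = 1 :=
  Matrix.nonsing_inv_mul _ (hg.det_ne_zero y hy).isUnit

lemma IsMetricOn.smooth_inv (hg : IsMetricOn g U) : SmoothMat (fun z => (g z)⁻¹) U :=
  hg.smooth.inv hg.det_ne_zero

lemma IsMetricOn.christoffel_symm (hg : IsMetricOn g U) (p i j : Fin n) (y : Coord n) :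
    christoffel g p i j y = christoffel g p j i y := by
  have h : (fun z => g z i j) = fun z => g z j i := funext fun z => hg.apply_symm z i j
  simp only [christoffel, h]
  congr 1
  exact Finset.sum_congr rfl fun q _ => by ring

lemma IsMetricOn.smooth_christoffel (hg : IsMetricOn g U) (p i j : Fin n) :
    ContDiffOn ℝ ∞ (christoffel g p i j) U := by
  have hU := hg.isOpen
  refine contDiffOn_const.mul (ContDiffOn.sum fun q _ => (hg.smooth_inv p q).mul ?_)
  exact ((smooth_pd i hU (hg.smooth j q)).add (smooth_pd j hU (hg.smooth i q))).sub
    (smooth_pd q hU (hg.smooth i j))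

lemma IsMetricOn.smooth_conn (hg : IsMetricOn g U) (i : Fin n) : SmoothMat (conn g i) U :=
  fun l k => hg.smooth_christoffel l i k

/-- Lowering the upper index removes the inverse metric and leaves the Christoffel symbols of the
first kind. -/
lemma IsMetricOn.metric_mul_conn (hg : IsMetricOn g U) (hy : y ∈ U) (i l k : Fin n) :
    (g y * conn g i y) l k = (1 / 2) * (pd i (fun z => g z k l) y + pd k (fun z => g z i l) y
      - pd l (fun z => g z i k) y) := by
  have h : conn g i y = (g y)⁻¹ * Matrix.of fun q k => (1 / 2) *
      (pd i (fun z => g z k q) y + pd k (fun z => g z i q) y - pd q (fun z => g z i k) y) := by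
    ext l k
    simp only [conn, christoffel, Matrix.of_apply, Matrix.mul_apply, Finset.mul_sum]
    exact Finset.sum_congr rfl fun q _ => by ring
  rw [h, ← Matrix.mul_assoc, hg.mul_inv hy, Matrix.one_mul, Matrix.of_apply]

/-- The Levi-Civita connection is metric. -/
lemma IsMetricOn.pdMat_metric (hg : IsMetricOn g U) (hy : y ∈ U) (i : Fin n) :
    pdMat i g y = (conn g i y).transpose * g y + g y * conn g i y := by
  have h : (conn g i y).transpose * g y = (g y * conn g i y).transpose := by
    rw [Matrix.transpose_mul, hg.symm]
  have hs : ∀ a b, (fun z => g z a b) = fun z => g z b a := fun a b =>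
    funext fun z => hg.apply_symm z a b
  ext a b
  rw [h, Matrix.add_apply, Matrix.transpose_apply, hg.metric_mul_conn hy, hg.metric_mul_conn hy]
  simp only [pdMat, Matrix.of_apply]
  rw [hs b a, hs i a, hs i b]
  ring

/-- Differentiate `g⁻¹ g = 1` and insert metric compatibility of the connection. -/
lemma IsMetricOn.pdMat_inv (hg : IsMetricOn g U) (hy : y ∈ U) (i : Fin n) :
    pdMat i (fun z => (g z)⁻¹) y
      = -((g y)⁻¹ * (conn g i y).transpose) - conn g i y * (g y)⁻¹ := by
  have h0 : pdMat i (fun z => (g z)⁻¹ * g z) y = 0 := by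
    rw [pdMat_congr i hg.isOpen hy fun z hz => hg.inv_mul hz]
    exact pdMat_const i 1 y
  rw [pdMat_mul i hg.isOpen hg.smooth_inv hg.smooth hy, hg.pdMat_metric hy] at h0
  have h1 : pdMat i (fun z => (g z)⁻¹) y * g y
      = -((g y)⁻¹ * ((conn g i y).transpose * g y + g y * conn g i y)) := by
    rw [eq_neg_iff_add_eq_zero, h0]
  have h2 := congrArg (· * (g y)⁻¹) h1
  simp only [Matrix.mul_assoc, hg.mul_inv hy, Matrix.mul_one] at h2
  rw [h2, Matrix.mul_add, Matrix.neg_mul, Matrix.add_mul]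
  simp only [Matrix.mul_assoc, hg.mul_inv hy, Matrix.mul_one]
  rw [← Matrix.mul_assoc ((g y)⁻¹) (g y), hg.inv_mul hy, Matrix.one_mul]
  abel

/-- The covariant derivative `D_m f_{ij}`, as a matrix. -/
def covMat (g : Comp2 n) (m : Fin n) (f : Comp2 n) : Comp2 n := fun y =>
  pdMat m f y - (conn g m y).transpose * f y - f y * conn g m y

lemma covMat_apply (g : Comp2 n) (m : Fin n) (f : Comp2 n) (y : Coord n) (i j : Fin n) :
    covMat g m f y i j = pd m (fun z => f z i j) y - ∑ r, christoffel g r m i y * f y r j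
      - ∑ r, christoffel g r m j y * f y i r := by
  simp only [covMat, Matrix.sub_apply, Matrix.mul_apply, pdMat, conn, Matrix.transpose_apply,
    Matrix.of_apply]
  congr 1
  exact Finset.sum_congr rfl fun r _ => mul_comm _ _

lemma IsMetricOn.trace_inv_mul (hg : IsMetricOn g U) (y : Coord n)
    (A : Matrix (Fin n) (Fin n) ℝ) : ∑ i, ∑ j, (g y)⁻¹ i j * A i j = ((g y)⁻¹ * A).trace := by
  simp only [Matrix.trace, Matrix.diag, Matrix.mul_apply]
  rw [Finset.sum_comm]
  exact Finset.sum_congr rfl fun i _ => Finset.sum_congr rfl fun j _ => by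
    rw [hg.inv_apply_symm]

lemma IsMetricOn.trace2_eq (hg : IsMetricOn g U) (f : Comp2 n) (y : Coord n) :
    trace2 g f y = ((g y)⁻¹ * f y).trace := hg.trace_inv_mul y (f y)

lemma IsMetricOn.smooth_trace2 (hg : IsMetricOn g U) {f : Comp2 n} (hf : SmoothMat f U) :
    ContDiffOn ℝ ∞ (trace2 g f) U :=
  ContDiffOn.sum fun i _ => ContDiffOn.sum fun j _ => (hg.smooth_inv i j).mul (hf i j)

/-- The trace commutes with the covariant derivative. -/
lemma IsMetricOn.pd_trace2 (hg : IsMetricOn g U) {f : Comp2 n} (hf : SmoothMat f U)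
    (hy : y ∈ U) (m : Fin n) : pd m (trace2 g f) y = trace2 g (covMat g m f) y := by
  have h : trace2 g f = fun z => ((g z)⁻¹ * f z).trace := funext fun z => hg.trace2_eq f z
  rw [h, pd_trace m hg.isOpen (hg.smooth_inv.mul hf) hy,
    pdMat_mul m hg.isOpen hg.smooth_inv hf hy, hg.pdMat_inv hy, hg.trace2_eq]
  simp only [covMat, Matrix.sub_mul, Matrix.neg_mul, Matrix.mul_sub, Matrix.trace_add,
    Matrix.trace_sub, Matrix.trace_neg]
  -- The derivative of `g⁻¹` gives two connection terms. One already matches the left correction in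
  -- `covMat`; cyclicity of the trace turns the other into the right correction.
  have : (conn g m y * (g y)⁻¹ * f y).trace = ((g y)⁻¹ * (f y * conn g m y)).trace := by
    rw [← Matrix.mul_assoc, ← Matrix.trace_mul_cycle, Matrix.mul_assoc]
  rw [this, Matrix.mul_assoc]
  ring

lemma IsMetricOn.covMat_metric (hg : IsMetricOn g U) (hy : y ∈ U) (m : Fin n) :
    covMat g m g y = 0 := by
  rw [covMat, hg.pdMat_metric hy]
  abel

end Metric

/-! ### Curvature identities -/

section Curvature

variable {n : ℕ} {g : Comp2 n} {y : Coord n} {U : Set (Coord n)}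

/-- The curvature endomorphism `(R_{ijk}^l)_{l,k}`. -/
def curvMat (g : Comp2 n) (i j : Fin n) : Comp2 n := fun y =>
  Matrix.of fun l k => riemann g i j k l y

/-- In terms of connection matrices `A_i` the curvature is `∂_i A_j - ∂_j A_i + [A_i, A_j]`; this
makes the curvature identities computations in a noncommutative ring. -/
lemma curvMat_eq (g : Comp2 n) (i j : Fin n) : curvMat g i j = fun y =>
    pdMat i (conn g j) y - pdMat j (conn g i) y
      + (conn g i y * conn g j y - conn g j y * conn g i y) := by
  funext y
  ext l k
  simp only [curvMat, riemann, Matrix.of_apply, Matrix.add_apply, Matrix.sub_apply,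
    Matrix.mul_apply, pdMat, conn, ← Finset.sum_sub_distrib]

lemma curvMat_antisymm (g : Comp2 n) (i j : Fin n) (y : Coord n) :
    curvMat g i j y = -curvMat g j i y := by
  simp only [curvMat_eq]
  abel

lemma IsMetricOn.smooth_curvMat (hg : IsMetricOn g U) (i j : Fin n) :
    SmoothMat (curvMat g i j) U := by
  have hA := hg.smooth_conn
  have hU := hg.isOpen
  rw [curvMat_eq]
  exact (((hA j).pdMat i hU).sub ((hA i).pdMat j hU)).add
    (((hA i).mul (hA j)).sub ((hA j).mul (hA i)))

lemma IsMetricOn.smooth_ricci (hg : IsMetricOn g U) : SmoothMat (ricci g) U := fun i j =>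
  ContDiffOn.sum (f := fun p z => curvMat g p i z p j) (s := Finset.univ)
    fun p _ => hg.smooth_curvMat p i p j

lemma IsMetricOn.pdMat_curvMat (hg : IsMetricOn g U) (hy : y ∈ U) (m i j : Fin n) :
    pdMat m (curvMat g i j) y = pdMat m (pdMat i (conn g j)) y - pdMat m (pdMat j (conn g i)) y
      + ((pdMat m (conn g i) y * conn g j y + conn g i y * pdMat m (conn g j) y)
      - (pdMat m (conn g j) y * conn g i y + conn g j y * pdMat m (conn g i) y)) := by
  have hA := hg.smooth_conn
  have hU := hg.isOpen
  rw [curvMat_eq,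
    pdMat_add m hU (((hA j).pdMat i hU).sub ((hA i).pdMat j hU))
      (((hA i).mul (hA j)).sub ((hA j).mul (hA i))) hy,
    pdMat_sub m hU ((hA j).pdMat i hU) ((hA i).pdMat j hU) hy,
    pdMat_sub m hU ((hA i).mul (hA j)) ((hA j).mul (hA i)) hy,
    pdMat_mul m hU (hA i) (hA j) hy, pdMat_mul m hU (hA j) (hA i) hy]

/-- The differential Bianchi identity, in terms of the connection matrices. -/
lemma IsMetricOn.bianchi (hg : IsMetricOn g U) (hy : y ∈ U) (m i j : Fin n) :
    (pdMat m (curvMat g i j) y + (conn g m y * curvMat g i j y - curvMat g i j y * conn g m y))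
    + (pdMat i (curvMat g j m) y + (conn g i y * curvMat g j m y - curvMat g j m y * conn g i y))
    + (pdMat j (curvMat g m i) y
      + (conn g j y * curvMat g m i y - curvMat g m i y * conn g j y)) = 0 := by
  have hA := hg.smooth_conn
  have hU := hg.isOpen
  -- Second derivatives cancel in the cyclic sum because partial derivatives commute; the remaining
  -- terms cancel by the Leibniz expansion of the commutators and the Jacobi identity.
  rw [hg.pdMat_curvMat hy, hg.pdMat_curvMat hy, hg.pdMat_curvMat hy,
    pdMat_comm j i hU (hA m) hy, pdMat_comm j m hU (hA i) hy, pdMat_comm i m hU (hA j) hy]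
  simp only [curvMat_eq]
  noncomm_ring

/-- The curvature endomorphisms are skew with respect to the metric. -/
lemma IsMetricOn.curvMat_skew (hg : IsMetricOn g U) (hy : y ∈ U) (i j : Fin n) :
    (curvMat g i j y).transpose * g y + g y * curvMat g i j y = 0 := by
  have hA := hg.smooth_conn
  have hU := hg.isOpen
  have key : ∀ a b : Fin n, pdMat a (pdMat b g) y
      = (pdMat a (conn g b) y).transpose * g y
        + (conn g b y).transpose * ((conn g a y).transpose * g y + g y * conn g a y)
        + (((conn g a y).transpose * g y + g y * conn g a y) * conn g b y
        + g y * pdMat a (conn g b) y) := by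
    intro a b
    rw [pdMat_congr a hU hy fun z hz => hg.pdMat_metric hz b,
      pdMat_add a hU ((hA b).transpose.mul hg.smooth) (hg.smooth.mul (hA b)) hy,
      pdMat_mul a hU (hA b).transpose hg.smooth hy, pdMat_mul a hU hg.smooth (hA b) hy,
      pdMat_transpose, hg.pdMat_metric hy]
  -- Computing `∂_i ∂_j g` in both orders through metric compatibility, the difference is the
  -- asserted skewness.
  have h := pdMat_comm i j hU hg.smooth hy
  rw [key, key, ← sub_eq_zero] at h
  rw [curvMat_eq, ← h]
  simp only [Matrix.transpose_add, Matrix.transpose_sub, Matrix.transpose_mul]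
  noncomm_ring

/-- By skewness the transpose of the curvature endomorphism is conjugate to its negative, so the
trace equals its own negative. -/
lemma IsMetricOn.trace_curvMat (hg : IsMetricOn g U) (hy : y ∈ U) (i j : Fin n) :
    (curvMat g i j y).trace = 0 := by
  have h : (curvMat g i j y).transpose = -(g y * curvMat g i j y * (g y)⁻¹) := by
    have := congrArg (· * (g y)⁻¹) (eq_neg_of_add_eq_zero_left (hg.curvMat_skew hy i j))
    simpa only [Matrix.mul_assoc, hg.mul_inv hy, Matrix.mul_one, Matrix.neg_mul] using this
  have h2 := congrArg Matrix.trace h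
  rw [Matrix.trace_transpose, Matrix.trace_neg, Matrix.trace_mul_comm, ← Matrix.mul_assoc,
    hg.inv_mul hy, Matrix.one_mul] at h2
  linarith

/-- The algebraic Bianchi identity. -/
lemma IsMetricOn.first_bianchi (hg : IsMetricOn g U) (i j k l : Fin n) (y : Coord n) :
    riemann g i j k l y + riemann g j k i l y + riemann g k i j l y = 0 := by
  have h : ∀ p a b, christoffel g p a b = christoffel g p b a := fun p a b =>
    funext fun z => hg.christoffel_symm p a b z
  simp only [riemann]
  rw [h l k j, h l k i, h l j i]
  have : (∑ p, (christoffel g l i p y * christoffel g p j k y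
        - christoffel g l j p y * christoffel g p i k y))
      + (∑ p, (christoffel g l j p y * christoffel g p k i y
        - christoffel g l k p y * christoffel g p j i y))
      + (∑ p, (christoffel g l k p y * christoffel g p i j y
        - christoffel g l i p y * christoffel g p k j y)) = 0 := by
    rw [← Finset.sum_add_distrib, ← Finset.sum_add_distrib]
    refine Finset.sum_eq_zero fun p _ => ?_
    rw [h p k j, h p k i, h p j i]
    ring
  linarith

lemma ricci_eq (g : Comp2 n) (i j : Fin n) (y : Coord n) :
    ricci g y i j = ∑ p, curvMat g p i y p j := rfl

/-- Contract the algebraic Bianchi identity: the middle term is the trace of a curvature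
endomorphism, hence zero, and the third is `-R_{ji}` by antisymmetry. -/
lemma IsMetricOn.ricci_symm (hg : IsMetricOn g U) (hy : y ∈ U) (i j : Fin n) :
    ricci g y i j = ricci g y j i := by
  have h : ∑ p, (riemann g p i j p y + riemann g i j p p y + riemann g j p i p y) = 0 :=
    Finset.sum_eq_zero fun p _ => hg.first_bianchi p i j p y
  have ht : ∑ p, riemann g i j p p y = 0 := hg.trace_curvMat hy i j
  have ha : ∀ p, riemann g j p i p y = -riemann g p j i p y := fun p =>
    congrFun (congrFun (curvMat_antisymm g j p y) p) i
  simp only [Finset.sum_add_distrib, ht, ha, Finset.sum_neg_distrib] at h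
  change ∑ p, riemann g p i j p y = ∑ p, riemann g p j i p y
  linarith

/-- The curvature with its last index lowered, `R_{ijkl}` as a matrix in `l, k`. -/
def lowMat (g : Comp2 n) (i j : Fin n) : Comp2 n := fun y => g y * curvMat g i j y

lemma lowMat_antisymm (g : Comp2 n) (i j : Fin n) (y : Coord n) :
    lowMat g i j y = -lowMat g j i y := by
  rw [lowMat, curvMat_antisymm, Matrix.mul_neg, lowMat]

lemma IsMetricOn.lowMat_skew (hg : IsMetricOn g U) (hy : y ∈ U) (i j k l : Fin n) :
    lowMat g i j y l k = -lowMat g i j y k l := by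
  have h : (lowMat g i j y).transpose = -lowMat g i j y := by
    rw [lowMat, Matrix.transpose_mul, hg.symm]
    exact eq_neg_of_add_eq_zero_left (hg.curvMat_skew hy i j)
  exact congrFun (congrFun h k) l

lemma IsMetricOn.smooth_lowMat (hg : IsMetricOn g U) (i j : Fin n) :
    SmoothMat (lowMat g i j) U := hg.smooth.mul (hg.smooth_curvMat i j)

/-- The metric is parallel, so lowering an index commutes with differentiation and only the
commutator with the connection matrix remains. -/
lemma IsMetricOn.covMat_lowMat (hg : IsMetricOn g U) (hy : y ∈ U) (m i j : Fin n) :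
    covMat g m (lowMat g i j) y = g y * (pdMat m (curvMat g i j) y
      + (conn g m y * curvMat g i j y - curvMat g i j y * conn g m y)) := by
  have h : lowMat g i j = fun z => g z * curvMat g i j z := rfl
  simp only [h, covMat]
  rw [pdMat_mul m hg.isOpen hg.smooth (hg.smooth_curvMat i j) hy, hg.pdMat_metric hy]
  noncomm_ring

/-- The covariant derivative `D_m R_{ijkl}` as a matrix in `l, k`. -/
def covLow (g : Comp2 n) (m i j : Fin n) : Comp2 n := fun y =>
  covMat g m (lowMat g i j) y - ∑ r, christoffel g r m i y • lowMat g r j y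
    - ∑ r, christoffel g r m j y • lowMat g i r y

lemma covLow_antisymm (g : Comp2 n) (m i j : Fin n) (y : Coord n) :
    covLow g m i j y = -covLow g m j i y := by
  have h : lowMat g i j = fun z => -lowMat g j i z := funext fun z => lowMat_antisymm g i j z
  have hc : covMat g m (lowMat g i j) y = -covMat g m (lowMat g j i) y := by
    rw [h]
    have : pdMat m (fun z => -lowMat g j i z) y = -pdMat m (lowMat g j i) y := by
      ext a b
      simp [pdMat, pd]
    simp only [covMat, this]
    noncomm_ring
  simp only [covLow, hc]
  have h1 : ∀ a b : Fin n, ∑ r, christoffel g r m a y • lowMat g r b y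
      = -∑ r, christoffel g r m a y • lowMat g b r y := fun a b => by
    rw [← Finset.sum_neg_distrib]
    exact Finset.sum_congr rfl fun r _ => by rw [lowMat_antisymm, smul_neg]
  rw [h1 i j, h1 j i]
  abel

/-- The differential Bianchi identity `D_{[m} R_{ij]kl} = 0`. -/
lemma IsMetricOn.bianchi_low (hg : IsMetricOn g U) (hy : y ∈ U) (m i j : Fin n) :
    covLow g m i j y + covLow g i j m y + covLow g j m i y = 0 := by
  have h := hg.bianchi hy m i j
  have h1 : covMat g m (lowMat g i j) y + covMat g i (lowMat g j m) y
      + covMat g j (lowMat g m i) y = 0 := by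
    rw [hg.covMat_lowMat hy, hg.covMat_lowMat hy, hg.covMat_lowMat hy, ← Matrix.mul_add,
      ← Matrix.mul_add, h, Matrix.mul_zero]
  -- The corrections for the two form indices cancel in pairs over the cyclic sum, by symmetry of
  -- `Γ` and antisymmetry of the curvature.
  have h2 : ∀ a b c : Fin n, ∑ r, christoffel g r a b y • lowMat g c r y
      = -∑ r, christoffel g r b a y • lowMat g r c y := fun a b c => by
    rw [← Finset.sum_neg_distrib]
    exact Finset.sum_congr rfl fun r _ => by
      rw [lowMat_antisymm, smul_neg, hg.christoffel_symm]
  simp only [covLow]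
  rw [h2 m j i, h2 i m j, h2 j i m, ← h1]
  abel

lemma covLow_apply (g : Comp2 n) (m i j l k : Fin n) (y : Coord n) :
    covLow g m i j y l k = pd m (fun z => lowMat g i j z l k) y
      - ∑ r, christoffel g r m l y * lowMat g i j y r k
      - ∑ r, christoffel g r m k y * lowMat g i j y l r
      - ∑ r, christoffel g r m i y * lowMat g r j y l k
      - ∑ r, christoffel g r m j y * lowMat g i r y l k := by
  simp only [covLow, Matrix.sub_apply, covMat_apply, Matrix.sum_apply, Matrix.smul_apply,
    smul_eq_mul]

lemma IsMetricOn.sum_inv_lowMat (hg : IsMetricOn g U) (hy : y ∈ U) (j k : Fin n) :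
    ∑ i, ∑ l, (g y)⁻¹ i l * lowMat g i j y l k = ricci g y j k := by
  rw [ricci_eq]
  refine Finset.sum_congr rfl fun i _ => ?_
  rw [← Matrix.mul_apply, lowMat, ← Matrix.mul_assoc, hg.inv_mul hy, Matrix.one_mul]

lemma sum4_swap {ι κ : Type*} [Fintype ι] [Fintype κ] (F : ι → ι → κ → κ → ℝ) :
    ∑ a, ∑ b, ∑ c, ∑ d, F a b c d = ∑ c, ∑ d, ∑ a, ∑ b, F a b c d := by
  calc ∑ a, ∑ b, ∑ c, ∑ d, F a b c d = ∑ a, ∑ c, ∑ b, ∑ d, F a b c d :=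
        Finset.sum_congr rfl fun a _ => Finset.sum_comm
    _ = ∑ c, ∑ a, ∑ b, ∑ d, F a b c d := Finset.sum_comm
    _ = ∑ c, ∑ a, ∑ d, ∑ b, F a b c d :=
        Finset.sum_congr rfl fun c _ => Finset.sum_congr rfl fun a _ => Finset.sum_comm
    _ = ∑ c, ∑ d, ∑ a, ∑ b, F a b c d := Finset.sum_congr rfl fun c _ => Finset.sum_comm

/-- Contracting a term with a spectator index. -/
lemma sum_contract_spectator {ι : Type*} [Fintype ι] (G : Matrix ι ι ℝ) (c : ι → ℝ)
    (F : ι → ι → ι → ℝ) : ∑ i, ∑ l, G i l * ∑ r, c r * F i l r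
      = ∑ r, c r * ∑ i, ∑ l, G i l * F i l r := by
  simp only [Finset.mul_sum]
  rw [Finset.sum_congr rfl fun i _ => Finset.sum_comm, Finset.sum_comm]
  exact Finset.sum_congr rfl fun r _ => Finset.sum_congr rfl fun i _ =>
    Finset.sum_congr rfl fun l _ => by ring

/-- Contraction commutes with `D`. With `j` and `k` frozen, `pd_trace2` treats the two contracted
indices; the Christoffel corrections of `j` and `k` pass through the contraction as spectators. -/
lemma IsMetricOn.sum_inv_covLow_outer (hg : IsMetricOn g U) (hy : y ∈ U) (m j k : Fin n) :
    ∑ i, ∑ l, (g y)⁻¹ i l * covLow g m i j y l k = covMat g m (ricci g) y j k := by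
  have hf : SmoothMat (fun z => Matrix.of fun i l => lowMat g i j z l k) U := fun i l =>
    hg.smooth_lowMat i j l k
  have h := hg.pd_trace2 hf hy m
  have h0 : pd m (trace2 g fun z => Matrix.of fun i l => lowMat g i j z l k) y
      = pd m (fun z => ricci g z j k) y :=
    pd_congr m hg.isOpen hy fun z hz => hg.sum_inv_lowMat hz j k
  rw [h0] at h
  simp only [trace2, covMat_apply, Matrix.of_apply, mul_sub, Finset.sum_sub_distrib] at h
  rw [covMat_apply, h]
  simp only [covLow_apply, mul_sub, Finset.sum_sub_distrib]
  have e1 := sum_contract_spectator (g y)⁻¹ (fun r => christoffel g r m k y)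
    fun i l r => lowMat g i j y l r
  have e2 := sum_contract_spectator (g y)⁻¹ (fun r => christoffel g r m j y)
    fun i l r => lowMat g i r y l k
  simp only [hg.sum_inv_lowMat hy] at e1 e2
  rw [e1, e2]
  ring

/-- The other Ricci contraction of `DR`; the sign comes from skewness in the lowered endomorphism
indices. -/
lemma IsMetricOn.sum_inv_covLow_inner (hg : IsMetricOn g U) (hy : y ∈ U) (i m l : Fin n) :
    ∑ j, ∑ k, (g y)⁻¹ j k * covLow g i j m y l k = -covMat g i (ricci g) y m l := by
  have hR : ∀ z ∈ U, ∀ a b, ∑ j, ∑ k, (g z)⁻¹ j k * lowMat g j a z b k = -ricci g z a b := by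
    intro z hz a b
    rw [← hg.sum_inv_lowMat hz, ← Finset.sum_neg_distrib]
    refine Finset.sum_congr rfl fun j _ => ?_
    rw [← Finset.sum_neg_distrib]
    refine Finset.sum_congr rfl fun k _ => ?_
    rw [hg.lowMat_skew hz, mul_neg]
  have hf : SmoothMat (fun z => Matrix.of fun j k => lowMat g j m z l k) U := fun j k =>
    hg.smooth_lowMat j m l k
  have h := hg.pd_trace2 hf hy i
  have h0 : pd i (trace2 g fun z => Matrix.of fun j k => lowMat g j m z l k) y
      = -pd i (fun z => ricci g z m l) y := by
    have h1 : pd i (trace2 g fun z => Matrix.of fun j k => lowMat g j m z l k) y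
        = pd i (fun z => -ricci g z m l) y :=
      pd_congr i hg.isOpen hy fun z hz => hR z hz m l
    rw [h1]
    simp [pd]
  rw [h0] at h
  simp only [trace2, covMat_apply, Matrix.of_apply, mul_sub, Finset.sum_sub_distrib] at h
  simp only [covMat_apply, neg_sub]
  simp only [covLow_apply, mul_sub, Finset.sum_sub_distrib]
  have e1 := sum_contract_spectator (g y)⁻¹ (fun r => christoffel g r i l y)
    fun j k r => lowMat g j m y r k
  have e2 := sum_contract_spectator (g y)⁻¹ (fun r => christoffel g r i m y)
    fun j k r => lowMat g j r y l k
  simp only [hR y hy, mul_neg, Finset.sum_neg_distrib] at e1 e2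
  rw [e1, e2]
  linarith

/-- The contracted differential Bianchi identity. -/
lemma IsMetricOn.pd_scal (hg : IsMetricOn g U) (hy : y ∈ U) (m : Fin n) :
    pd m (scal g) y = 2 * ∑ i, ∑ l, (g y)⁻¹ i l * covMat g i (ricci g) y m l := by
  -- Trace the differential Bianchi identity twice: one cyclic term gives `dR`, the other two each
  -- give minus the divergence of Ricci.
  have h1 : ∑ j, ∑ k, ∑ i, ∑ l, (g y)⁻¹ j k * ((g y)⁻¹ i l * covLow g m i j y l k)
      = pd m (scal g) y := by
    have : scal g = trace2 g (ricci g) := rfl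
    rw [this, hg.pd_trace2 hg.smooth_ricci hy]
    simp only [← Finset.mul_sum, hg.sum_inv_covLow_outer hy, trace2]
  have h2 : ∑ j, ∑ k, ∑ i, ∑ l, (g y)⁻¹ j k * ((g y)⁻¹ i l * covLow g i j m y l k)
      = -∑ i, ∑ l, (g y)⁻¹ i l * covMat g i (ricci g) y m l := by
    rw [sum4_swap, ← Finset.sum_neg_distrib]
    refine Finset.sum_congr rfl fun i _ => ?_
    rw [← Finset.sum_neg_distrib]
    refine Finset.sum_congr rfl fun l _ => ?_
    rw [← mul_neg, ← hg.sum_inv_covLow_inner hy]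
    simp only [Finset.mul_sum]
    exact Finset.sum_congr rfl fun j _ => Finset.sum_congr rfl fun k _ => by ring
  have h3 : ∑ j, ∑ k, ∑ i, ∑ l, (g y)⁻¹ j k * ((g y)⁻¹ i l * covLow g j m i y l k)
      = -∑ i, ∑ l, (g y)⁻¹ i l * covMat g i (ricci g) y m l := by
    simp only [← Finset.sum_neg_distrib, ← Finset.mul_sum]
    refine Finset.sum_congr rfl fun j _ => Finset.sum_congr rfl fun k _ => ?_
    rw [← mul_neg, ← hg.sum_inv_covLow_outer hy, ← Finset.sum_neg_distrib]
    congr 1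
    refine Finset.sum_congr rfl fun i _ => ?_
    rw [← Finset.sum_neg_distrib]
    refine Finset.sum_congr rfl fun l _ => ?_
    rw [covLow_antisymm, Matrix.neg_apply, mul_neg]
  have h4 : ∑ j, ∑ k, ∑ i, ∑ l, (g y)⁻¹ j k * ((g y)⁻¹ i l *
      (covLow g m i j y + covLow g i j m y + covLow g j m i y) l k) = 0 := by
    simp only [hg.bianchi_low hy, Matrix.zero_apply, mul_zero, Finset.sum_const_zero]
  simp only [Matrix.add_apply, mul_add, Finset.sum_add_distrib, h1, h2, h3] at h4
  linarith

end Curvature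

/-! ### Divergences of rank two tensors -/

section Divergence

variable {n : ℕ} {g : Comp2 n} {y : Coord n} {U : Set (Coord n)}

lemma div2_eq (g s : Comp2 n) (j : Fin n) (y : Coord n) :
    div2 g s j y = ∑ p, ∑ q, (g y)⁻¹ p q * covMat g q s y p j := by
  simp only [div2, divg]
  refine Finset.sum_congr rfl fun p _ => Finset.sum_congr rfl fun q _ => ?_
  rw [covMat_apply]
  simp [covD, Fin.sum_univ_two, Function.update, sub_sub]

lemma div2_congr {s t : Comp2 n} (hU : IsOpen U) (hy : y ∈ U) (h : ∀ z ∈ U, s z = t z)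
    (j : Fin n) : div2 g s j y = div2 g t j y := by
  simp only [div2_eq, covMat]
  rw [h y hy]
  simp only [pdMat_congr _ hU hy h]

lemma div2_add {s t : Comp2 n} (hU : IsOpen U) (hs : SmoothMat s U) (ht : SmoothMat t U)
    (hy : y ∈ U) (j : Fin n) :
    div2 g (fun z => s z + t z) j y = div2 g s j y + div2 g t j y := by
  simp only [div2_eq, covMat]
  rw [← Finset.sum_add_distrib]
  refine Finset.sum_congr rfl fun p _ => ?_
  rw [← Finset.sum_add_distrib]
  refine Finset.sum_congr rfl fun q _ => ?_
  rw [pdMat_add _ hU hs ht hy, ← mul_add, ← Matrix.add_apply, Matrix.mul_add, Matrix.add_mul]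
  congr 1
  refine congrFun (congrFun ?_ p) j
  abel

lemma covMat_smul {f : Coord n → ℝ} {s : Comp2 n} (hU : IsOpen U) (hf : ContDiffOn ℝ ∞ f U)
    (hs : SmoothMat s U) (hy : y ∈ U) (m : Fin n) :
    covMat g m (fun z => f z • s z) y = pd m f y • s y + f y • covMat g m s y := by
  have : pdMat m (fun z => f z • s z) y = pd m f y • s y + f y • pdMat m s y := by
    ext i j
    exact pd_mul m (diffAt_of_smooth hU hf hy) (diffAt_of_smooth hU (hs i j) hy)
  simp only [covMat, this, smul_sub, Matrix.mul_smul, Matrix.smul_mul]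
  abel

lemma IsMetricOn.div2_smul_metric (hg : IsMetricOn g U) {f : Coord n → ℝ}
    (hf : ContDiffOn ℝ ∞ f U) (hy : y ∈ U) (j : Fin n) :
    div2 g (fun z => f z • g z) j y = pd j f y := by
  simp only [div2_eq, covMat_smul hg.isOpen hf hg.smooth hy, hg.covMat_metric hy, smul_zero,
    add_zero, Matrix.smul_apply, smul_eq_mul]
  rw [Finset.sum_comm]
  have : ∀ q, ∑ p, (g y)⁻¹ p q * (pd q f y * g y p j) = pd q f y * (1 : Matrix _ _ ℝ) q j := by
    intro q
    rw [← hg.inv_mul hy, Matrix.mul_apply, Finset.mul_sum]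
    exact Finset.sum_congr rfl fun p _ => by rw [hg.inv_apply_symm]; ring
  simp [this, Matrix.one_apply]

lemma covMat_transpose (g s : Comp2 n) (m : Fin n) (y : Coord n) :
    covMat g m (fun z => (s z).transpose) y = (covMat g m s y).transpose := by
  simp only [covMat, pdMat_transpose, Matrix.transpose_sub, Matrix.transpose_mul,
    Matrix.transpose_transpose]
  abel

lemma covMat_congr {s t : Comp2 n} (hU : IsOpen U) (hy : y ∈ U) (h : ∀ z ∈ U, s z = t z)
    (m : Fin n) : covMat g m s y = covMat g m t y := by
  simp only [covMat, h y hy, pdMat_congr _ hU hy h]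

lemma IsMetricOn.div2_ricci (hg : IsMetricOn g U) (hy : y ∈ U) (j : Fin n) :
    div2 g (ricci g) j y = (1 / 2) * pd j (scal g) y := by
  rw [hg.pd_scal hy, div2_eq, ← mul_assoc]
  norm_num
  rw [Finset.sum_comm]
  refine Finset.sum_congr rfl fun q _ => Finset.sum_congr rfl fun p _ => ?_
  rw [hg.inv_apply_symm]
  congr 1
  -- `pd_scal` contracts the derivative with the second index of Ricci and `div2` with the first;
  -- symmetry of Ricci reconciles them.
  have : covMat g q (ricci g) y = (covMat g q (ricci g) y).transpose := by
    rw [← covMat_transpose]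
    exact covMat_congr hg.isOpen hy (fun z hz => by ext a b; exact hg.ricci_symm hz a b) q
  conv_lhs => rw [this]
  rfl

lemma IsMetricOn.smooth_scal (hg : IsMetricOn g U) : ContDiffOn ℝ ∞ (scal g) U :=
  hg.smooth_trace2 hg.smooth_ricci

/-- By the contracted Bianchi identity the divergences of `R_{ij}` and `-(1/2) R h_{ij}` cancel, so
only the `κ` term survives. -/
lemma IsMetricOn.div2_einsteinTensor (hg : IsMetricOn g U) {κ : Coord n → ℝ}
    (hκ : ContDiffOn ℝ ∞ κ U) (hy : y ∈ U) (j : Fin n) :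
    div2 g (einsteinTensor g κ) j y = ((n : ℝ) - 2) / (2 * (n : ℝ)) * pd j κ y := by
  have hf : ContDiffOn ℝ ∞
      (fun z => ((n : ℝ) - 2) / (2 * (n : ℝ)) * κ z + (-(1 / 2)) * scal g z) U :=
    (contDiffOn_const.mul hκ).add (contDiffOn_const.mul hg.smooth_scal)
  have h : einsteinTensor g κ = fun z => ricci g z
      + (((n : ℝ) - 2) / (2 * (n : ℝ)) * κ z + (-(1 / 2)) * scal g z) • g z := by
    funext z
    simp only [einsteinTensor, add_smul, neg_mul, neg_smul]
    abel
  have hκ' := diffAt_of_smooth hg.isOpen hκ hy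
  have hs' := diffAt_of_smooth hg.isOpen hg.smooth_scal hy
  rw [h, div2_add hg.isOpen hg.smooth_ricci (hg.smooth.smul hf) hy, hg.div2_smul_metric hf hy,
    hg.div2_ricci hy, pd_add j (hκ'.const_mul _) (hs'.const_mul _), pd_const_mul j _ hκ',
    pd_const_mul j _ hs']
  ring

end Divergence

/-! ### Complete contractions -/

section Contract

variable {n k : ℕ}

/-- Splitting off the first slot allows induction on the rank and reduces each step to a trace of a
rank two tensor. -/
lemma contract_succ (G : Matrix (Fin n) (Fin n) ℝ) (A B : (Fin (k + 1) → Fin n) → ℝ) :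
    contract G A B = ∑ p, ∑ q, G p q *
      contract G (fun I : Fin k → Fin n => A (Fin.cons p I : Fin (k + 1) → Fin n))
        (fun J : Fin k → Fin n => B (Fin.cons q J : Fin (k + 1) → Fin n)) := by
  have h : ∀ f : (Fin (k + 1) → Fin n) → ℝ, ∑ I, f I
      = ∑ p : Fin n, ∑ I : Fin k → Fin n, f (Fin.cons p I : Fin (k + 1) → Fin n) := fun f => by
    rw [← (Fin.consEquiv fun _ : Fin (k + 1) => Fin n).sum_comp, Fintype.sum_prod_type]
    rfl
  simp only [contract, h, Fin.prod_univ_succ, Fin.cons_zero, Fin.cons_succ, Finset.mul_sum]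
  refine Finset.sum_congr rfl fun p _ => ?_
  rw [Finset.sum_comm]
  exact Finset.sum_congr rfl fun q _ => Finset.sum_congr rfl fun I _ =>
    Finset.sum_congr rfl fun J _ => by ring

lemma contract_zero_rank (G : Matrix (Fin n) (Fin n) ℝ) (A B : (Fin 0 → Fin n) → ℝ) :
    contract G A B = A Fin.elim0 * B Fin.elim0 := by
  simp [contract, Subsingleton.elim (default : Fin 0 → Fin n) Fin.elim0]

/-- The contraction as a bilinear map. -/
def contractBilin (n k : ℕ) (G : Matrix (Fin n) (Fin n) ℝ) :
    ((Fin k → Fin n) → ℝ) →ₗ[ℝ] ((Fin k → Fin n) → ℝ) →ₗ[ℝ] ℝ :=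
  LinearMap.mk₂ ℝ (contract G)
    (fun A A' B => by
      simp only [contract, ← Finset.sum_add_distrib, Pi.add_apply, mul_add, add_mul])
    (fun c A B => by
      simp only [contract, smul_eq_mul, Finset.mul_sum, Pi.smul_apply]
      exact Finset.sum_congr rfl fun I _ => Finset.sum_congr rfl fun J _ => by ring)
    (fun A B B' => by
      simp only [contract, ← Finset.sum_add_distrib, Pi.add_apply, mul_add])
    (fun c A B => by
      simp only [contract, smul_eq_mul, Finset.mul_sum, Pi.smul_apply]
      exact Finset.sum_congr rfl fun I _ => Finset.sum_congr rfl fun J _ => by ring)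

variable {G : Matrix (Fin n) (Fin n) ℝ} {A A' B B' : (Fin k → Fin n) → ℝ}

lemma contract_sub_left :
    contract G (fun I => A I - A' I) B = contract G A B - contract G A' B :=
  LinearMap.map_sub₂ (contractBilin n k G) A A' B

lemma contract_sub_right :
    contract G A (fun I => B I - B' I) = contract G A B - contract G A B' :=
  map_sub (contractBilin n k G A) B B'

lemma contract_mul_right (c : ℝ) :
    contract G A (fun I => c * B I) = c * contract G A B :=
  map_smul (contractBilin n k G A) c B

lemma contract_mul_left (c : ℝ) :
    contract G (fun I => c * A I) B = c * contract G A B :=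
  LinearMap.map_smul₂ (contractBilin n k G) c A B

lemma contract_sum_right {ι : Type*} (s : Finset ι) (F : ι → (Fin k → Fin n) → ℝ) :
    contract G A (fun I => ∑ a ∈ s, F a I) = ∑ a ∈ s, contract G A (F a) := by
  have h : (fun I => ∑ a ∈ s, F a I) = ∑ a ∈ s, F a := by
    ext I
    simp
  rw [h]
  exact map_sum (contractBilin n k G A) F s

lemma contract_sum_left {ι : Type*} (s : Finset ι) (F : ι → (Fin k → Fin n) → ℝ) :
    contract G (fun I => ∑ a ∈ s, F a I) B = ∑ a ∈ s, contract G (F a) B := by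
  have h : (fun I => ∑ a ∈ s, F a I) = ∑ a ∈ s, F a := by
    ext I
    simp
  rw [h]
  exact LinearMap.map_sum₂ (contractBilin n k G) s F B

lemma contract_zero_right : contract G A (fun _ => 0) = 0 :=
  map_zero (contractBilin n k G A)

lemma contract_zero_left : contract G (fun _ => 0) B = 0 :=
  LinearMap.map_zero₂ (contractBilin n k G) B

lemma contract_comm (hG : ∀ i j, G i j = G j i) : contract G A B = contract G B A := by
  simp only [contract]
  rw [Finset.sum_comm]
  refine Finset.sum_congr rfl fun J _ => Finset.sum_congr rfl fun I _ => ?_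
  rw [Finset.prod_congr rfl fun s _ => hG (I s) (J s)]
  ring

lemma contract_perm (σ : Equiv.Perm (Fin k)) :
    contract G (fun I => A fun s => I (σ s)) (fun I => B fun s => I (σ s))
      = contract G A B := by
  simp only [contract]
  rw [← (Equiv.arrowCongr σ (Equiv.refl (Fin n))).sum_comp]
  refine Finset.sum_congr rfl fun I _ => ?_
  rw [← (Equiv.arrowCongr σ (Equiv.refl (Fin n))).sum_comp]
  refine Finset.sum_congr rfl fun J _ => ?_
  simp only [Equiv.arrowCongr_apply, Equiv.coe_refl, Function.comp_apply, id,
    Equiv.symm_apply_apply]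
  rw [← Equiv.prod_comp σ]
  simp

/-- Against a symmetric tensor the slots of the other factor may be permuted freely; this is used to
bring a chosen slot to the front. -/
lemma contract_perm_right (σ : Equiv.Perm (Fin k)) (hA : ∀ I, (A fun s => I (σ s)) = A I) :
    contract G A (fun I => B fun s => I (σ s)) = contract G A B := by
  rw [← contract_perm σ (A := A) (B := B)]
  simp only [hA]

end Contract

/-! ### The Leibniz rule for contractions -/

section Leibniz

variable {n k : ℕ} {g : Comp2 n} {y : Coord n} {U : Set (Coord n)}

/-- The components of `A` are smooth on `U`. -/
def SmoothComp (A : Comp n k) (U : Set (Coord n)) : Prop :=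
  ∀ I, ContDiffOn ℝ ∞ (fun y => A y I) U

lemma IsMetricOn.smooth_contract (hg : IsMetricOn g U) {A B : Comp n k} (hA : SmoothComp A U)
    (hB : SmoothComp B U) : ContDiffOn ℝ ∞ (fun z => contract (g z)⁻¹ (A z) (B z)) U :=
  ContDiffOn.sum fun I _ => ContDiffOn.sum fun J _ =>
    ((contDiffOn_prod fun s _ => hg.smooth_inv (I s) (J s)).mul (hA I)).mul (hB J)

/-- Freezing the first index as a parameter omits exactly its own Christoffel correction. -/
lemma covD_cons (g : Comp2 n) (A : Comp n (k + 1)) (m p : Fin n) (I : Fin k → Fin n)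
    (y : Coord n) :
    covD g A m (Fin.cons p I : Fin (k + 1) → Fin n) y
      = covD g (fun z J => A z (Fin.cons p J : Fin (k + 1) → Fin n)) m I y
        - ∑ r, christoffel g r m p y * A y (Fin.cons r I : Fin (k + 1) → Fin n) := by
  simp only [covD, Fin.sum_univ_succ, Fin.cons_zero, Fin.cons_succ, Fin.update_cons_zero,
    ← Fin.cons_update]
  ring

/-- The rank two tensor `G^{IJ} A_{pI} B_{qJ}`. -/
def partialContract (g : Comp2 n) (A B : Comp n (k + 1)) : Comp2 n := fun z =>
  Matrix.of fun p q => contract (g z)⁻¹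
    (fun I : Fin k → Fin n => A z (Fin.cons p I : Fin (k + 1) → Fin n))
    (fun I : Fin k → Fin n => B z (Fin.cons q I : Fin (k + 1) → Fin n))

lemma IsMetricOn.smooth_partialContract (hg : IsMetricOn g U) {A B : Comp n (k + 1)}
    (hA : SmoothComp A U) (hB : SmoothComp B U) : SmoothMat (partialContract g A B) U :=
  fun p q => hg.smooth_contract (A := fun z I => A z (Fin.cons p I : Fin (k + 1) → Fin n))
    (B := fun z I => B z (Fin.cons q I : Fin (k + 1) → Fin n)) (fun _ => hA _) fun _ => hB _

lemma trace2_partialContract (g : Comp2 n) (A B : Comp n (k + 1)) (y : Coord n) :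
    trace2 g (partialContract g A B) y = contract (g y)⁻¹ (A y) (B y) := by
  rw [contract_succ]
  rfl

/-- The Leibniz rule with frozen first indices is taken as a hypothesis, so that the statement
serves both within the induction on the rank and after it. -/
lemma covMat_partialContract_of_leibniz {A B : Comp n (k + 1)} {m p q : Fin n}
    (h : pd m (fun z => partialContract g A B z p q) y
      = contract (g y)⁻¹
          (fun I => covD g (fun z J => A z (Fin.cons p J : Fin (k + 1) → Fin n)) m I y)
          (fun I => B y (Fin.cons q I : Fin (k + 1) → Fin n))
        + contract (g y)⁻¹ (fun I => A y (Fin.cons p I : Fin (k + 1) → Fin n))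
          (fun I => covD g (fun z J => B z (Fin.cons q J : Fin (k + 1) → Fin n)) m I y)) :
    covMat g m (partialContract g A B) y p q
      = contract (g y)⁻¹ (fun I => covD g A m (Fin.cons p I : Fin (k + 1) → Fin n) y)
          (fun I => B y (Fin.cons q I : Fin (k + 1) → Fin n))
        + contract (g y)⁻¹ (fun I => A y (Fin.cons p I : Fin (k + 1) → Fin n))
          (fun I => covD g B m (Fin.cons q I : Fin (k + 1) → Fin n) y) := by
  rw [covMat_apply, h]
  simp only [covD_cons, contract_sub_left, contract_sub_right, contract_sum_left,
    contract_sum_right, contract_mul_left, contract_mul_right, partialContract, Matrix.of_apply]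
  ring

/-- The Leibniz rule `∂_m (A^I B_I) = (D_m A)^I B_I + A^I D_m B_I`. -/
lemma IsMetricOn.pd_contract (hg : IsMetricOn g U) (hy : y ∈ U) (m : Fin n) :
    ∀ {k : ℕ} {A B : Comp n k}, SmoothComp A U → SmoothComp B U →
    pd m (fun z => contract (g z)⁻¹ (A z) (B z)) y
      = contract (g y)⁻¹ (fun I => covD g A m I y) (B y)
        + contract (g y)⁻¹ (A y) (fun I => covD g B m I y)
  | 0, A, B, hA, hB => by
    simp only [contract_zero_rank]
    rw [pd_mul m (diffAt_of_smooth hg.isOpen (hA _) hy) (diffAt_of_smooth hg.isOpen (hB _) hy)]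
    simp [covD]
  | k + 1, A, B, hA, hB => by
    -- A contraction of rank `k + 1` is the trace of `partialContract`, whose entries are
    -- contractions of rank `k` and so are covered by the recursive call.
    have h : (fun z => contract (g z)⁻¹ (A z) (B z)) = trace2 g (partialContract g A B) :=
      funext fun z => (trace2_partialContract g A B z).symm
    rw [h, hg.pd_trace2 (hg.smooth_partialContract hA hB) hy, contract_succ, contract_succ,
      trace2, ← Finset.sum_add_distrib]
    refine Finset.sum_congr rfl fun p _ => ?_
    rw [← Finset.sum_add_distrib]
    refine Finset.sum_congr rfl fun q _ => ?_
    rw [← mul_add, covMat_partialContract_of_leibniz]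
    exact hg.pd_contract hy m (A := fun z J => A z (Fin.cons p J : Fin (k + 1) → Fin n))
      (B := fun z J => B z (Fin.cons q J : Fin (k + 1) → Fin n)) (fun _ => hA _) fun _ => hB _

lemma IsMetricOn.covMat_partialContract (hg : IsMetricOn g U) (hy : y ∈ U)
    {A B : Comp n (k + 1)} (hA : SmoothComp A U) (hB : SmoothComp B U) (m p q : Fin n) :
    covMat g m (partialContract g A B) y p q
      = contract (g y)⁻¹ (fun I => covD g A m (Fin.cons p I : Fin (k + 1) → Fin n) y)
          (fun I => B y (Fin.cons q I : Fin (k + 1) → Fin n))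
        + contract (g y)⁻¹ (fun I => A y (Fin.cons p I : Fin (k + 1) → Fin n))
          (fun I => covD g B m (Fin.cons q I : Fin (k + 1) → Fin n) y) :=
  covMat_partialContract_of_leibniz <|
    hg.pd_contract hy m (A := fun z J => A z (Fin.cons p J : Fin (k + 1) → Fin n))
      (B := fun z J => B z (Fin.cons q J : Fin (k + 1) → Fin n)) (fun _ => hA _) fun _ => hB _

end Leibniz

/-! ### Trace-free symmetric tensors -/

section SymmetricTensors

variable {n m : ℕ} {g : Comp2 n} {w : Comp n (m + 1)} {y : Coord n} {U : Set (Coord n)}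

/-- The trace of a tensor of rank `m + 1` vanishes at a point. -/
def TraceZeroAt (g : Comp2 n) : {m : ℕ} → Comp n (m + 1) → Coord n → Prop
  | 0, _, _ => True
  | _ + 1, w, y => ∀ I, tr g w y I = 0

/-- `w` is a smooth trace-free symmetric tensor on `U`. -/
structure IsTraceFreeSymOn (g : Comp2 n) (w : Comp n (m + 1)) (U : Set (Coord n)) : Prop where
  smooth : SmoothComp w U
  symm : ∀ (z : Coord n) (σ : Equiv.Perm (Fin (m + 1))) (I : Fin (m + 1) → Fin n),
    w z (fun s => I (σ s)) = w z I
  traceZero : ∀ y ∈ U, TraceZeroAt g w y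

lemma covD_symm (hw : ∀ (z : Coord n) (σ : Equiv.Perm (Fin (m + 1))) (I : Fin (m + 1) → Fin n),
    w z (fun s => I (σ s)) = w z I) (i : Fin n) (σ : Equiv.Perm (Fin (m + 1)))
    (I : Fin (m + 1) → Fin n) (y : Coord n) :
    covD g w i (fun s => I (σ s)) y = covD g w i I y := by
  simp only [covD, hw]
  congr 1
  rw [← Equiv.sum_comp σ (fun s => ∑ p, christoffel g p i (I s) y
    * w y (Function.update I s p))]
  refine Finset.sum_congr rfl fun s _ => Finset.sum_congr rfl fun p _ => ?_
  congr 1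
  refine Eq.trans (congrArg (w y) ?_) (hw y σ _)
  funext t
  by_cases h : t = s
  · subst h; simp
  · simp [h]

/-- Of the four terms of the Ricci trace, two contain a trace of `ω` and vanish. The other two are
equal by the symmetry of `ω` and add up, with their factors `1/2`, to `ω_i^P ω_{jP}`. -/
lemma ricWedge_eq (hg : IsMetricOn g U) (hw : IsTraceFreeSymOn g w U) (hy : y ∈ U) :
    ricWedge g w y = partialContract g w w y := by
  have hG := hg.inv_apply_symm y
  cases m with
  | zero =>
    ext i j
    have h : ∀ a : Fin n, (Fin.cons a Fin.elim0 : Fin 1 → Fin n) = fun _ => a := fun a => by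
      funext s
      exact Fin.cases rfl (fun t => t.elim0) s
    simp only [ricWedge, partialContract, Matrix.of_apply, contract_zero_rank, h]
  | succ r =>
    have htr : ∀ I, tr g w y I = 0 := hw.traceZero y hy
    have htr1 : (fun I => ∑ p, ∑ q, (g y)⁻¹ p q * w y (Fin.cons p (Fin.cons q I :
        Fin (r + 1) → Fin n) : Fin (r + 2) → Fin n)) = fun _ => 0 := funext htr
    have hswap : ∀ (a b : Fin n) (I : Fin r → Fin n),
        w y (Fin.cons a (Fin.cons b I : Fin (r + 1) → Fin n) : Fin (r + 2) → Fin n)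
        = w y (Fin.cons b (Fin.cons a I : Fin (r + 1) → Fin n) : Fin (r + 2) → Fin n) := by
      intro a b I
      rw [← hw.symm y (Equiv.swap 0 1)]
      congr 1
      funext s
      refine Fin.cases (by simp) (fun t => Fin.cases ?_ (fun u => ?_) t) s
      · simp
      · rw [Equiv.swap_apply_of_ne_of_ne (by simp)
          (by simp [Fin.ext_iff])]
        simp
    set F : Fin n → Fin n → Fin n → Fin n → ℝ := fun a b c d => contract (g y)⁻¹
      (fun P : Fin r → Fin n =>
        w y (Fin.cons a (Fin.cons b P : Fin (r + 1) → Fin n) : Fin (r + 2) → Fin n))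
      (fun P : Fin r → Fin n =>
        w y (Fin.cons c (Fin.cons d P : Fin (r + 1) → Fin n) : Fin (r + 2) → Fin n)) with hF
    have hFl : ∀ a b c d, F a b c d = F b a c d := fun a b c d => by simp only [hF, hswap a b]
    have hFr : ∀ a b c d, F a b c d = F a b d c := fun a b c d => by simp only [hF, hswap c d]
    have hFs : ∀ a b c d, F a b c d = F c d a b := fun a b c d => contract_comm hG
    have hF0 : ∀ a b, ∑ p, ∑ q, (g y)⁻¹ p q * F a b p q = 0 := fun a b => by
      simp only [hF, ← contract_mul_right, ← contract_sum_right]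
      rw [htr1, contract_zero_right]
    have hterm : ∀ i j p q, 1 / 2 * (F j p i q - F j i p q) - 1 / 2 * (F q p i j - F q i p j)
        = F i q j p - 1 / 2 * (F j i p q + F i j p q) := fun i j p q => by
      rw [hFs j p, hFs q p, hFr i j q p, hFl q i, hFr i q p j]
      ring
    ext i j
    have hR : partialContract g w w y i j = ∑ p, ∑ q, (g y)⁻¹ p q * F i p j q := by
      simp only [partialContract, Matrix.of_apply]
      rw [contract_succ]
    have hL : ricWedge g w y i j = ∑ p, ∑ q, (g y)⁻¹ p q *
      (1 / 2 * (F j p i q - F j i p q) - 1 / 2 * (F q p i j - F q i p j)) := rfl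
    rw [hL, hR]
    simp only [hterm]
    simp only [mul_sub, mul_left_comm _ (1 / 2 : ℝ), mul_add, Finset.sum_sub_distrib,
      Finset.sum_add_distrib, ← Finset.mul_sum, hF0]
    rw [Finset.sum_comm]
    simp only [add_zero, mul_zero, sub_zero]
    exact Finset.sum_congr rfl fun p _ => Finset.sum_congr rfl fun q _ => by rw [hG q p]

end SymmetricTensors

/-! ### The pairing one-forms -/

section Pairings

variable {n m : ℕ} {g : Comp2 n} {w : Comp n (m + 1)} {y : Coord n} {U : Set (Coord n)}

/-- The one-form `ω^{pP} D_p ω_{jP}`. -/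
def transportPairing (g : Comp2 n) (w : Comp n (m + 1)) (j : Fin n) (y : Coord n) : ℝ :=
  contract (g y)⁻¹ (w y)
    (fun P => covD g w (P 0) (Fin.cons j (Fin.tail P) : Fin (m + 1) → Fin n) y)

lemma IsMetricOn.pd_normSq (hg : IsMetricOn g U) (hw : SmoothComp w U) (hy : y ∈ U)
    (i : Fin n) :
    pd i (normSq g w) y = 2 * contract (g y)⁻¹ (w y) (fun P => covD g w i P y) := by
  have h := hg.pd_contract hy i hw hw
  rw [contract_comm (A := fun I => covD g w i I y) (hg.inv_apply_symm y)] at h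
  change pd i (fun z => contract (g z)⁻¹ (w z) (w z)) y = _
  rw [h]
  ring

/-- The derivative falls either on the factor carrying the contracted index, giving the divergence
pairing, or on the other factor, giving the transport term. -/
lemma IsMetricOn.div2_partialContract (hg : IsMetricOn g U) (hw : SmoothComp w U) (hy : y ∈ U)
    (j : Fin n) : div2 g (partialContract g w w) j y
      = divPairing g w j y + transportPairing g w j y := by
  have h1 : divPairing g w j y = ∑ p, ∑ q, (g y)⁻¹ p q * contract (g y)⁻¹
      (fun I : Fin m → Fin n => covD g w q (Fin.cons p I : Fin (m + 1) → Fin n) y)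
      (fun I : Fin m → Fin n => w y (Fin.cons j I : Fin (m + 1) → Fin n)) := by
    simp only [← contract_mul_left, ← contract_sum_left]
    exact contract_comm (hg.inv_apply_symm y)
  rw [h1, transportPairing, contract_succ, ← Finset.sum_add_distrib, div2_eq]
  refine Finset.sum_congr rfl fun p _ => ?_
  rw [← Finset.sum_add_distrib]
  refine Finset.sum_congr rfl fun q _ => ?_
  rw [hg.covMat_partialContract hy hw hw, mul_add]
  simp only [Fin.cons_zero, Fin.tail_cons]

lemma IsMetricOn.sum_inv_mul_metric (hg : IsMetricOn g U) (hy : y ∈ U) (p i : Fin n) :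
    ∑ q, (g y)⁻¹ p q * g y q i = if p = i then 1 else 0 := by
  rw [← Matrix.mul_apply, hg.inv_mul hy, Matrix.one_apply]

/-- Contracting a factor `h_{q i}` against the first index. -/
lemma IsMetricOn.contract_metric_first (hg : IsMetricOn g U) (hy : y ∈ U)
    {A B : (Fin (m + 1) → Fin n) → ℝ} {C : (Fin m → Fin n) → ℝ} {i : Fin n}
    (hB : ∀ q Q, B (Fin.cons q Q : Fin (m + 1) → Fin n) = g y q i * C Q) :
    contract (g y)⁻¹ A B
      = contract (g y)⁻¹ (fun P : Fin m → Fin n => A (Fin.cons i P : Fin (m + 1) → Fin n)) C := by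
  rw [contract_succ]
  simp only [hB, contract_mul_right, ← mul_assoc, ← Finset.sum_mul, hg.sum_inv_mul_metric hy]
  simp

/-- Contracting a factor `h_{q p}` against the first two indices of a trace-free tensor. -/
lemma IsMetricOn.contract_metric_trace (hg : IsMetricOn g U) (hy : y ∈ U)
    {w : Comp n (m + 2)} {B : (Fin (m + 2) → Fin n) → ℝ} {C : (Fin m → Fin n) → ℝ}
    (hw : ∀ I, tr g w y I = 0)
    (hB : ∀ p q Q, B (Fin.cons p (Fin.cons q Q : Fin (m + 1) → Fin n) : Fin (m + 2) → Fin n)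
      = g y q p * C Q) :
    contract (g y)⁻¹ (w y) B = 0 := by
  have h1 : ∀ p q : Fin n, contract (g y)⁻¹
      (fun I : Fin (m + 1) → Fin n => w y (Fin.cons p I : Fin (m + 2) → Fin n))
      (fun J : Fin (m + 1) → Fin n => B (Fin.cons q J : Fin (m + 2) → Fin n))
      = contract (g y)⁻¹ (fun P : Fin m → Fin n =>
          w y (Fin.cons p (Fin.cons q P : Fin (m + 1) → Fin n) : Fin (m + 2) → Fin n)) C :=
    fun p q => hg.contract_metric_first hy fun r Q => hB q r Q
  rw [contract_succ]
  simp only [h1, ← contract_mul_left, ← contract_sum_left]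
  have h2 : (fun I => ∑ p, ∑ q, (g y)⁻¹ p q * w y (Fin.cons p (Fin.cons q I :
      Fin (m + 1) → Fin n) : Fin (m + 2) → Fin n)) = fun _ => 0 := funext hw
  rw [h2, contract_zero_left]

/-- The contraction of `ω^P` with `h_{P_s i} div(ω)`, for a slot `s` other than the first. -/
lemma IsTraceFreeSymOn.contract_metric_div (hg : IsMetricOn g U) (hw : IsTraceFreeSymOn g w U)
    (hy : y ∈ U) (i : Fin n) (s : Fin m) :
    contract (g y)⁻¹ (w y) (fun P => g y (Fin.tail P s) i
      * divg g w y (Function.update (Fin.tail P) s (P 0))) = divPairing g w i y := by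
  -- Symmetry of `ω` moves the slot carrying the metric factor to the front; the index `P 0` then
  -- lands in the slot `s` of the divergence.
  rw [← contract_perm_right (Equiv.swap 0 s.succ) (hw.symm y _)]
  refine hg.contract_metric_first hy fun q Q => ?_
  congr 1
  · simp [Fin.tail]
  · congr 1
    funext t
    by_cases h : t = s
    · subst h; simp
    · have : (t.succ : Fin (m + 1)) ≠ s.succ := fun h' => h (Fin.succ_injective _ h')
      simp [h, Fin.tail, Equiv.swap_apply_of_ne_of_ne (Fin.succ_ne_zero t) this]

/-- The contraction of `ω^P` with a term containing `h_{P_s P_0}` vanishes. -/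
lemma IsTraceFreeSymOn.contract_metric_pair (hg : IsMetricOn g U)
    (hw : IsTraceFreeSymOn g w U) (hy : y ∈ U) (i : Fin n) (s : Fin m) :
    contract (g y)⁻¹ (w y) (fun P => g y (Fin.tail P s) (P 0)
      * divg g w y (Function.update (Fin.tail P) s i)) = 0 := by
  cases m with
  | zero => exact s.elim0
  | succ r =>
    -- After this swap the metric factor sits on the first two slots, where it traces `ω`.
    rw [← contract_perm_right (Equiv.swap 1 s.succ) (hw.symm y _)]
    have h0 : Equiv.swap (1 : Fin (r + 2)) s.succ 0 = 0 :=
      Equiv.swap_apply_of_ne_of_ne (by simp) (Fin.succ_ne_zero s).symm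
    -- The remaining factor does not depend on the first two indices, since slot `s` is overwritten
    -- by `i`; in the witness `C` they are filled with the dummy value `i`.
    refine hg.contract_metric_trace hy (hw.traceZero y hy)
      (C := fun Q => divg g w y (Function.update (Fin.tail fun t =>
        (Fin.cons i (Fin.cons i Q : Fin (r + 1) → Fin n) : Fin (r + 2) → Fin n)
          (Equiv.swap 1 s.succ t)) s i)) fun p q Q => ?_
    congr 1
    · simp [Fin.tail, h0]
    · congr 1
      funext t
      by_cases h : t = s
      · subst h; simp
      · simp only [Function.update_of_ne h, Fin.tail]
        have h1 : Equiv.swap (1 : Fin (r + 2)) s.succ t.succ ≠ 1 := fun h' => by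
          rw [Equiv.swap_apply_eq_iff, Equiv.swap_apply_left] at h'
          exact h (Fin.succ_injective _ h')
        have h2 : Equiv.swap (1 : Fin (r + 2)) s.succ t.succ ≠ 0 := fun h' => by
          rw [Equiv.swap_apply_eq_iff, h0] at h'
          exact Fin.succ_ne_zero t h'
        obtain ⟨u, hu⟩ := Fin.exists_succ_eq.2 h2
        rw [← hu] at h1 ⊢
        have h3 : u ≠ 0 := fun h' => h1 (by rw [h']; rfl)
        obtain ⟨v, hv⟩ := Fin.exists_succ_eq.2 h3
        rw [← hv]
        simp

/-- Each metric correction contracts either to the divergence pairing, zero by hypothesis, or to a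
trace of `ω`. Hence the coefficient in front of the corrections is irrelevant. -/
lemma IsTraceFreeSymOn.codazziPairing_eq (hg : IsMetricOn g U) (hw : IsTraceFreeSymOn g w U)
    (hy : y ∈ U) (i : Fin n) (hdiv : divPairing g w i y = 0) :
    codazziPairing g w i y = 1 / 4 * pd i (normSq g w) y - 1 / 2 * transportPairing g w i y := by
  rw [hg.pd_normSq hw.smooth hy]
  simp only [codazziPairing, codazzi, contract_sub_right, contract_mul_right,
    contract_sum_right, hw.contract_metric_div hg hy, hw.contract_metric_pair hg hy, hdiv,
    Fin.cons_self_tail]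
  simp only [sub_zero, mul_zero, Finset.sum_const_zero, transportPairing]
  ring

/-- The sum over the permutations of an index `iP`, organized by the position of `i`. -/
lemma contract_sum_perm_cons {r : ℕ} {G : Matrix (Fin n) (Fin n) ℝ} {A : (Fin r → Fin n) → ℝ}
    (hA : ∀ (σ : Equiv.Perm (Fin r)) (I : Fin r → Fin n), A (fun s => I (σ s)) = A I)
    (T : (Fin (r + 1) → Fin n) → ℝ) (i : Fin n) :
    ∑ σ : Equiv.Perm (Fin (r + 1)), contract G A
        (fun P => T fun s => (Fin.cons i P : Fin (r + 1) → Fin n) (σ s))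
      = (r.factorial : ℝ) * ∑ p : Fin (r + 1), contract G A
        (fun P => T fun s => (Fin.cons i P : Fin (r + 1) → Fin n) (Equiv.swap 0 p s)) := by
  -- The index `i` stands at position `σ⁻¹ 0`, whereas `decomposeFin` records the image of `0`;
  -- hence the passage to inverses.
  rw [← Equiv.sum_comp (Equiv.inv (Equiv.Perm (Fin (r + 1)))),
    ← Equiv.sum_comp (Equiv.Perm.decomposeFin (n := r)).symm, Fintype.sum_prod_type,
    Finset.mul_sum]
  refine Finset.sum_congr rfl fun p _ => ?_
  have h : ∀ e : Equiv.Perm (Fin r), contract G A (fun P => T fun s =>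
      (Fin.cons i P : Fin (r + 1) → Fin n)
        (Equiv.inv _ (Equiv.Perm.decomposeFin.symm (p, e)) s))
      = contract G A
        (fun P => T fun s => (Fin.cons i P : Fin (r + 1) → Fin n) (Equiv.swap 0 p s)) := by
    intro e
    -- The permutation `e` of the remaining slots is absorbed by the symmetry of `A`, so each
    -- position of `i` occurs with multiplicity `r!`.
    rw [← contract_perm_right (B := fun P => T fun s =>
      (Fin.cons i P : Fin (r + 1) → Fin n) (Equiv.swap 0 p s)) e⁻¹ (hA e⁻¹)]
    congr 1
    funext P
    congr 1
    funext x
    obtain ⟨z, rfl⟩ := (Equiv.Perm.decomposeFin.symm (p, e)).surjective x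
    have hz : Equiv.inv _ (Equiv.Perm.decomposeFin.symm (p, e))
      (Equiv.Perm.decomposeFin.symm (p, e) z) = z := by simp
    rw [hz]
    refine Fin.cases ?_ (fun u => ?_) z
    · simp
    · simp
  simp only [h, Finset.sum_const, Finset.card_univ, Fintype.card_perm, Fintype.card_fin,
    nsmul_eq_mul]

lemma cons_swap_zero {r : ℕ} (i : Fin n) (P : Fin (r + 1) → Fin n) (s : Fin (r + 1)) :
    (fun t => (Fin.cons i P : Fin (r + 2) → Fin n) (Equiv.swap 0 s.succ t))
      = (Fin.cons (P s) (Function.update P s i) : Fin (r + 2) → Fin n) := by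
  funext t
  refine Fin.cases (by simp) (fun u => ?_) t
  by_cases h : u = s
  · subst h; simp
  · have : (u.succ : Fin (r + 2)) ≠ s.succ := fun h' => h (Fin.succ_injective _ h')
    simp [h, Equiv.swap_apply_of_ne_of_ne (Fin.succ_ne_zero u) this]

/-- Both `ω` and its covariant derivative are symmetric in the tensor slots, so slot `s` may be
exchanged with slot `0`. -/
lemma IsTraceFreeSymOn.contract_covD_update (hw : IsTraceFreeSymOn g w U) (i : Fin n)
    (s : Fin (m + 1)) :
    contract (g y)⁻¹ (w y) (fun P => covD g w (P s) (Function.update P s i) y)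
      = transportPairing g w i y := by
  rw [transportPairing, ← contract_perm_right (B := fun P => covD g w (P 0) _ y)
    (Equiv.swap 0 s) (hw.symm y _)]
  congr 1
  funext P
  simp only [Equiv.swap_apply_left]
  rw [← covD_symm hw.symm (P s) (Equiv.swap 0 s) (Function.update P s i)]
  congr 1
  funext t
  refine Fin.cases (by simp) (fun u => ?_) t
  have : Equiv.swap 0 s u.succ ≠ s := fun h' => by
    rw [Equiv.swap_apply_eq_iff, Equiv.swap_apply_right] at h'
    exact Fin.succ_ne_zero u h'
  simp [this, Fin.tail]

/-- For `s = 0` the contraction is the divergence pairing; for any other `s` the metric factor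
traces `ω`. -/
lemma IsTraceFreeSymOn.contract_metric_div_update (hg : IsMetricOn g U)
    (hw : IsTraceFreeSymOn g w U) (hy : y ∈ U) (i : Fin n) (hdiv : divPairing g w i y = 0)
    (s : Fin (m + 1)) :
    contract (g y)⁻¹ (w y) (fun P => g y (P s) (Function.update P s i 0)
      * divg g w y (Fin.tail (Function.update P s i))) = 0 := by
  refine Fin.cases ?_ (fun t => ?_) s
  · rw [← hdiv]
    refine hg.contract_metric_first hy fun q Q => ?_
    simp
  · rw [← hw.contract_metric_pair hg hy i t]
    congr 1
    funext P
    congr 2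
    exact Fin.tail_update_succ P t i

/-- The tensor whose symmetrization is the conformal Killing operator. -/
def preKilling (g : Comp2 n) (w : Comp n (m + 1)) (y : Coord n) (J : Fin (m + 2) → Fin n) : ℝ :=
  covD g w (J 0) (Fin.tail J) y - (((m : ℝ) + 1) / ((n : ℝ) + 2 * (m : ℝ))) *
    (g y (J 0) (J 1) * divg g w y (Fin.tail (Fin.tail J)))

lemma confKillingPairing_eq_sum (hw : IsTraceFreeSymOn g w U) (i : Fin n) :
    confKillingPairing g w i y = 1 / ((m + 2).factorial : ℝ) * (((m + 1).factorial : ℝ) *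
      ∑ p : Fin (m + 2), contract (g y)⁻¹ (w y) (fun P => preKilling g w y
        fun s => (Fin.cons i P : Fin (m + 2) → Fin n) (Equiv.swap 0 p s))) := by
  rw [← contract_sum_perm_cons (hw.symm y), ← contract_sum_right, ← contract_mul_right]
  rfl

/-- Sort the symmetrization by the position of `i`: the derivative slot gives `(1/2) d|ω|²`, each of
the `m + 1 = k` tensor slots gives the transport term, and every metric correction vanishes. The
prefactor is `(m+1)!/(m+2)!`. -/
lemma IsTraceFreeSymOn.confKillingPairing_eq (hg : IsMetricOn g U)
    (hw : IsTraceFreeSymOn g w U) (hy : y ∈ U) (i : Fin n) (hdiv : divPairing g w i y = 0) :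
    confKillingPairing g w i y = 1 / ((m : ℝ) + 2) *
      (1 / 2 * pd i (normSq g w) y + ((m : ℝ) + 1) * transportPairing g w i y) := by
  rw [hg.pd_normSq hw.smooth hy]
  rw [confKillingPairing_eq_sum hw, Fin.sum_univ_succ]
  have h0 : contract (g y)⁻¹ (w y) (fun P => g y i (P 0) * divg g w y (Fin.tail P)) = 0 := by
    rw [← hdiv]
    refine hg.contract_metric_first hy fun q Q => ?_
    rw [hg.apply_symm]
    simp
  have h1 : ∀ (a : Fin n) (P : Fin (m + 1) → Fin n),
      (Fin.cons a P : Fin (m + 2) → Fin n) 1 = P 0 := fun a P => rfl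
  simp only [cons_swap_zero, Equiv.swap_self, Equiv.refl_apply]
  simp only [preKilling, Fin.cons_zero, Fin.tail_cons, contract_sub_right,
    contract_mul_right, h1, h0, hw.contract_covD_update,
    hw.contract_metric_div_update hg hy i hdiv]
  have hf : ((m + 1).factorial : ℝ) ≠ 0 := by positivity
  have hm : ((m : ℝ) + 2) ≠ 0 := by positivity
  simp only [mul_zero, sub_zero, Finset.sum_const, Finset.card_univ, Fintype.card_fin,
    nsmul_eq_mul, Nat.factorial_succ (m + 1)]
  push_cast
  field_simp
  ring

end Pairings

/-! ### The stress tensors -/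

section Stress

variable {n m : ℕ} {g : Comp2 n} {w : Comp n (m + 1)} {y : Coord n} {U : Set (Coord n)}

lemma IsTraceFreeSymOn.smooth_normSq (hg : IsMetricOn g U) (hw : IsTraceFreeSymOn g w U) :
    ContDiffOn ℝ ∞ (normSq g w) U := hg.smooth_contract hw.smooth hw.smooth

lemma IsTraceFreeSymOn.smooth_ricWedge (hg : IsMetricOn g U) (hw : IsTraceFreeSymOn g w U) :
    SmoothMat (ricWedge g w) U := fun i j =>
  (hg.smooth_partialContract hw.smooth hw.smooth i j).congr fun z hz => by
    rw [ricWedge_eq hg hw hz]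

lemma IsTraceFreeSymOn.trace2_ricWedge (hg : IsMetricOn g U) (hw : IsTraceFreeSymOn g w U)
    (hy : y ∈ U) : trace2 g (ricWedge g w) y = normSq g w y := by
  rw [normSq, ← trace2_partialContract]
  simp only [trace2, ricWedge_eq hg hw hy]

lemma IsTraceFreeSymOn.smooth_ricWedge_add (hg : IsMetricOn g U) (hw : IsTraceFreeSymOn g w U)
    (c : ℝ) : SmoothMat (fun z => ricWedge g w z + (c * normSq g w z) • g z) U :=
  (hw.smooth_ricWedge hg).add (hg.smooth.smul (contDiffOn_const.mul (hw.smooth_normSq hg)))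

/-- Treats `T⁺` and `T⁻` together, with `c = -1/2` and `c = 1/(2k)`. -/
lemma IsTraceFreeSymOn.div2_ricWedge_add (hg : IsMetricOn g U) (hw : IsTraceFreeSymOn g w U)
    (hy : y ∈ U) (c : ℝ) (j : Fin n) (hdiv : divPairing g w j y = 0) :
    div2 g (fun z => ricWedge g w z + (c * normSq g w z) • g z) j y
      = transportPairing g w j y + c * pd j (normSq g w) y := by
  have hN : ContDiffOn ℝ ∞ (fun z => c * normSq g w z) U :=
    contDiffOn_const.mul (hw.smooth_normSq hg)
  rw [div2_add hg.isOpen (hw.smooth_ricWedge hg) (hg.smooth.smul hN) hy,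
    hg.div2_smul_metric hN hy,
    pd_const_mul j c (diffAt_of_smooth hg.isOpen (hw.smooth_normSq hg) hy),
    div2_congr hg.isOpen hy fun z hz => ricWedge_eq hg hw hz,
    hg.div2_partialContract hw.smooth hy, hdiv, zero_add]

lemma stressPlus_eq (g : Comp2 n) (w : Comp n (m + 1)) : stressPlus g w
    = fun z => ricWedge g w z + (-(1 / 2) * normSq g w z) • g z := by
  funext z
  simp only [stressPlus, neg_mul, neg_smul, sub_eq_add_neg]

lemma stressMinus_eq (g : Comp2 n) (w : Comp n (m + 1)) : stressMinus g w
    = fun z => ricWedge g w z + ((1 / (2 * ((m : ℝ) + 1))) * normSq g w z) • g z := rfl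

/-- A vanishing Codazzi pairing makes the transport term equal to `(1/2) d|ω|²`. -/
lemma IsTraceFreeSymOn.div2_stressPlus (hg : IsMetricOn g U) (hw : IsTraceFreeSymOn g w U)
    (hy : y ∈ U) (j : Fin n) (hdiv : divPairing g w j y = 0)
    (hcod : codazziPairing g w j y = 0) : div2 g (stressPlus g w) j y = 0 := by
  rw [hw.codazziPairing_eq hg hy j hdiv] at hcod
  rw [stressPlus_eq, hw.div2_ricWedge_add hg hy _ j hdiv]
  linarith

/-- A vanishing conformal Killing pairing makes the transport term equal to `-(1/(2k)) d|ω|²`. -/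
lemma IsTraceFreeSymOn.div2_stressMinus (hg : IsMetricOn g U) (hw : IsTraceFreeSymOn g w U)
    (hy : y ∈ U) (j : Fin n) (hdiv : divPairing g w j y = 0)
    (hkil : confKillingPairing g w j y = 0) : div2 g (stressMinus g w) j y = 0 := by
  rw [hw.confKillingPairing_eq hg hy j hdiv] at hkil
  have hm : ((m : ℝ) + 1) ≠ 0 := by positivity
  have hm2 : ((m : ℝ) + 2) ≠ 0 := by positivity
  rw [stressMinus_eq, hw.div2_ricWedge_add hg hy _ j hdiv]
  field_simp at hkil ⊢
  linarith

end Stress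

/-! ### Pointwise limits of solutions of first order linear equations -/

section Limits

open MeasureTheory Filter Topology

variable {n : ℕ} {U W : Set (Coord n)}

/-- A finite family of pointwise convergent sequences of continuous functions is uniformly bounded
on a nonempty open subset of any given nonempty open set. -/
lemma exists_open_uniform_bound {C : Type*} [Finite C] {u : C → ℕ → Coord n → ℝ}
    {v : C → Coord n → ℝ} (hU : IsOpen U) (hne : U.Nonempty)
    (hu : ∀ c N, ContinuousOn (u c N) U)
    (hlim : ∀ c, ∀ y ∈ U, Tendsto (fun N => u c N y) atTop (𝓝 (v c y))) :
    ∃ W ⊆ U, IsOpen W ∧ W.Nonempty ∧ ∃ K : ℝ, ∀ c N, ∀ y ∈ W, |u c N y| ≤ K := by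
  obtain ⟨x, hx⟩ := hne
  obtain ⟨r, hr, hrU⟩ := Metric.nhds_basis_closedBall.mem_iff.1 (hU.mem_nhds hx)
  -- The closed sets where all the functions are bounded by `K`, enlarged by the complement of a
  -- ball so that they cover the whole complete space and Baire's theorem applies.
  set E : ℕ → Set (Coord n) := fun K => (Metric.ball x r)ᶜ ∪
    ⋂ c, ⋂ N, Metric.closedBall x r ∩ u c N ⁻¹' Metric.closedBall 0 K with hE
  have hEc : ∀ K, IsClosed (E K) := fun K =>
    Metric.isOpen_ball.isClosed_compl.union <| isClosed_iInter fun c => isClosed_iInter fun N =>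
      ((hu c N).mono hrU).preimage_isClosed_of_isClosed Metric.isClosed_closedBall
        Metric.isClosed_closedBall
  have hEU : ⋃ K, E K = Set.univ := by
    refine Set.eq_univ_of_forall fun y => Set.mem_iUnion.2 ?_
    by_cases hy : y ∈ Metric.ball x r
    · have hyc := Metric.ball_subset_closedBall hy
      have hb : ∀ c, ∃ K : ℝ, ∀ N, |u c N y| ≤ K := fun c => by
        obtain ⟨K, hK⟩ := (hlim c y (hrU hyc)).norm.bddAbove_range
        exact ⟨K, fun N => hK ⟨N, rfl⟩⟩
      choose K hK using hb
      obtain ⟨K', hK'⟩ := (Set.finite_range K).bddAbove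
      obtain ⟨k, hk⟩ := exists_nat_ge K'
      refine ⟨k, Or.inr ?_⟩
      simp only [Set.mem_iInter, Set.mem_inter_iff, Set.mem_preimage, mem_closedBall_zero_iff,
        Real.norm_eq_abs]
      exact fun c N => ⟨hyc, (hK c N).trans ((hK' ⟨c, rfl⟩).trans hk)⟩
    · exact ⟨0, Or.inl hy⟩
  have hd := dense_iUnion_interior_of_closed hEc hEU
  obtain ⟨y, hyB, hyE⟩ := hd.inter_open_nonempty _ Metric.isOpen_ball ⟨x, Metric.mem_ball_self hr⟩
  obtain ⟨K, hK⟩ := Set.mem_iUnion.1 hyE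
  refine ⟨Metric.ball x r ∩ interior (E K), fun z hz => hrU (Metric.ball_subset_closedBall hz.1),
    Metric.isOpen_ball.inter isOpen_interior, ⟨y, hyB, hK⟩, K, fun c N z hz => ?_⟩
  rcases interior_subset hz.2 with h | h
  · exact absurd hz.1 h
  · simp only [Set.mem_iInter, Set.mem_inter_iff, Set.mem_preimage, mem_closedBall_zero_iff,
      Real.norm_eq_abs] at h
    exact (h c N).2

lemma continuous_mul_of_tsupport {χ f : Coord n → ℝ} (hU : IsOpen U) (hχ : Continuous χ)
    (hs : tsupport χ ⊆ U) (hf : ContinuousOn f U) : Continuous fun x => χ x * f x :=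
  continuous_of_tsupport fun _ hx =>
    hχ.continuousAt.mul (hf.continuousAt (hU.mem_nhds (hs (tsupport_mul_subset_left hx))))

lemma integrable_mul_of_tsupport {χ f : Coord n → ℝ} (hU : IsOpen U) (hχ : Continuous χ)
    (hc : HasCompactSupport χ) (hs : tsupport χ ⊆ U) (hf : ContinuousOn f U) :
    Integrable (fun x => χ x * f x) :=
  (continuous_mul_of_tsupport hU hχ hs hf).integrable_of_hasCompactSupport hc.mul_right

lemma contDiff_mul_of_tsupport {χ f : Coord n → ℝ} (hU : IsOpen U) (hχ : ContDiff ℝ ∞ χ)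
    (hs : tsupport χ ⊆ U) (hf : ContDiffOn ℝ ∞ f U) : ContDiff ℝ ∞ fun x => χ x * f x :=
  (contMDiff_of_tsupport fun _ hx => (hχ.contDiffAt.mul
    (hf.contDiffAt (hU.mem_nhds (hs (tsupport_mul_subset_left hx))))).contMDiffAt).contDiff

lemma continuous_pd {χ : Coord n → ℝ} (hχ : ContDiff ℝ ∞ χ) (q : Fin n) : Continuous (pd q χ) :=
  (hχ.continuous_fderiv (by simp)).clm_apply continuous_const

lemma tsupport_pd_subset (χ : Coord n → ℝ) (q : Fin n) : tsupport (pd q χ) ⊆ tsupport χ :=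
  tsupport_fderiv_apply_subset ℝ _

lemma hasCompactSupport_pd {χ : Coord n → ℝ} (hc : HasCompactSupport χ) (q : Fin n) :
    HasCompactSupport (pd q χ) := hc.fderiv_apply ℝ _

lemma integral_mul_pd {χ f : Coord n → ℝ} (hU : IsOpen U) (hχ : ContDiff ℝ ∞ χ)
    (hc : HasCompactSupport χ) (hs : tsupport χ ⊆ U) (hf : ContDiffOn ℝ ∞ f U) (q : Fin n) :
    ∫ x, χ x * pd q f x = -∫ x, pd q χ x * f x :=
  integral_mul_fderiv_eq_neg_fderiv_mul_of_integrable
    (integrable_mul_of_tsupport hU (continuous_pd hχ q) (hasCompactSupport_pd hc q)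
      ((tsupport_pd_subset χ q).trans hs) hf.continuousOn)
    (integrable_mul_of_tsupport hU hχ.continuous hc hs (smooth_pd q hU hf).continuousOn)
    (integrable_mul_of_tsupport hU hχ.continuous hc hs hf.continuousOn)
    (fun x _ => hχ.differentiable (by simp) x)
    (fun _ hx => diffAt_of_smooth hU hf (hs hx))

lemma tendsto_integral_mul {χ f : Coord n → ℝ} {F : ℕ → Coord n → ℝ} {K : ℝ} (hU : IsOpen U)
    (hχ : Continuous χ) (hc : HasCompactSupport χ) (hs : tsupport χ ⊆ U)
    (hF : ∀ N, ContinuousOn (F N) U) (hK : ∀ N, ∀ y ∈ U, |F N y| ≤ K)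
    (hlim : ∀ y ∈ U, Tendsto (fun N => F N y) atTop (𝓝 (f y))) :
    Tendsto (fun N => ∫ x, χ x * F N x) atTop (𝓝 (∫ x, χ x * f x)) := by
  refine tendsto_integral_of_dominated_convergence (fun x => |χ x| * K)
    (fun N => (continuous_mul_of_tsupport hU hχ hs (hF N)).aestronglyMeasurable)
    ((hχ.integrable_of_hasCompactSupport hc).abs.mul_const K) (fun N => ?_) ?_
  · refine Eventually.of_forall fun x => ?_
    by_cases hx : x ∈ tsupport χ
    · rw [norm_mul, Real.norm_eq_abs, Real.norm_eq_abs]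
      exact mul_le_mul_of_nonneg_left (hK N x (hs hx)) (abs_nonneg _)
    · simp [image_eq_zero_of_notMem_tsupport hx]
  · refine Eventually.of_forall fun x => ?_
    by_cases hx : x ∈ tsupport χ
    · exact (hlim x (hs hx)).const_mul _
    · simp [image_eq_zero_of_notMem_tsupport hx]

variable {C D : Type*} [Fintype C] [Fintype D]

/-- A first order linear differential expression. -/
def firstOrder (A : C → Coord n → ℝ) (q : C → Fin n) (B : D → Coord n → ℝ)
    (u : C → Coord n → ℝ) (v : D → Coord n → ℝ) (y : Coord n) : ℝ :=
  ∑ c, A c y * pd (q c) (u c) y + ∑ d, B d y * v d y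

variable {A : C → Coord n → ℝ} {q : C → Fin n} {B : D → Coord n → ℝ}

lemma continuousOn_firstOrder (hU : IsOpen U) (hA : ∀ c, ContDiffOn ℝ ∞ (A c) U)
    (hB : ∀ d, ContDiffOn ℝ ∞ (B d) U) {u : C → Coord n → ℝ} {v : D → Coord n → ℝ}
    (hu : ∀ c, ContDiffOn ℝ ∞ (u c) U) (hv : ∀ d, ContDiffOn ℝ ∞ (v d) U) :
    ContinuousOn (firstOrder A q B u v) U :=
  (continuousOn_finsetSum _ fun c _ =>
    (hA c).continuousOn.mul (smooth_pd (q c) hU (hu c)).continuousOn).add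
  (continuousOn_finsetSum _ fun d _ => (hB d).continuousOn.mul (hv d).continuousOn)

/-- The weak form of a first order linear differential expression. -/
lemma integral_mul_firstOrder (hU : IsOpen U) (hA : ∀ c, ContDiffOn ℝ ∞ (A c) U)
    (hB : ∀ d, ContDiffOn ℝ ∞ (B d) U) {u : C → Coord n → ℝ} {v : D → Coord n → ℝ}
    (hu : ∀ c, ContDiffOn ℝ ∞ (u c) U) (hv : ∀ d, ContDiffOn ℝ ∞ (v d) U)
    {φ : Coord n → ℝ} (hφ : ContDiff ℝ ∞ φ) (hc : HasCompactSupport φ) (hs : tsupport φ ⊆ U) :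
    ∫ x, φ x * firstOrder A q B u v x
      = ∑ c, -(∫ x, pd (q c) (fun z => φ z * A c z) x * u c x)
        + ∑ d, ∫ x, (φ x * B d x) * v d x := by
  have h1 : ∀ c, Integrable fun x => φ x * (A c x * pd (q c) (u c) x) := fun c =>
    integrable_mul_of_tsupport hU hφ.continuous hc hs
      ((hA c).continuousOn.mul (smooth_pd (q c) hU (hu c)).continuousOn)
  have h2 : ∀ d, Integrable fun x => φ x * (B d x * v d x) := fun d =>
    integrable_mul_of_tsupport hU hφ.continuous hc hs ((hB d).continuousOn.mul (hv d).continuousOn)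
  simp only [firstOrder, mul_add, Finset.mul_sum]
  rw [integral_add (integrable_finsetSum _ fun c _ => h1 c)
    (integrable_finsetSum _ fun d _ => h2 d), integral_finsetSum _ fun c _ => h1 c,
    integral_finsetSum _ fun d _ => h2 d]
  congr 1
  · refine Finset.sum_congr rfl fun c _ => ?_
    rw [← integral_mul_pd hU (contDiff_mul_of_tsupport hU hφ hs (hA c)) hc.mul_right
      (tsupport_mul_subset_left.trans hs) (hu c)]
    simp only [mul_assoc]
  · simp only [mul_assoc]

/-- A smooth pointwise limit of smooth solutions of a first order linear equation is a
solution. -/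
theorem firstOrder_eq_zero_of_tendsto (hU : IsOpen U) (hA : ∀ c, ContDiffOn ℝ ∞ (A c) U)
    (hB : ∀ d, ContDiffOn ℝ ∞ (B d) U) {u : C → Coord n → ℝ} {v : D → Coord n → ℝ}
    {u' : C → ℕ → Coord n → ℝ} {v' : D → ℕ → Coord n → ℝ}
    (hu : ∀ c, ContDiffOn ℝ ∞ (u c) U) (hv : ∀ d, ContDiffOn ℝ ∞ (v d) U)
    (hu' : ∀ c N, ContDiffOn ℝ ∞ (u' c N) U) (hv' : ∀ d N, ContDiffOn ℝ ∞ (v' d N) U)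
    (hul : ∀ c, ∀ y ∈ U, Tendsto (fun N => u' c N y) atTop (𝓝 (u c y)))
    (hvl : ∀ d, ∀ y ∈ U, Tendsto (fun N => v' d N y) atTop (𝓝 (v d y)))
    (h0 : ∀ N, ∀ y ∈ U, firstOrder A q B (fun c => u' c N) (fun d => v' d N) y = 0)
    {y : Coord n} (hy : y ∈ U) : firstOrder A q B u v y = 0 := by
  by_contra hne
  set P := firstOrder A q B u v with hP
  have hPc : ContinuousOn P U := continuousOn_firstOrder hU hA hB hu hv
  -- The uniform bound is sought inside the open set where the limit expression is nonzero, so that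
  -- its vanishing there is contradictory.
  have hZ : IsOpen (U ∩ P ⁻¹' {0}ᶜ) := hPc.isOpen_inter_preimage hU isOpen_compl_singleton
  obtain ⟨W, hWZ, hWo, hWne, K, hK⟩ := exists_open_uniform_bound
    (u := Sum.elim u' v') (v := Sum.elim u v) hZ ⟨y, hy, hne⟩
    (by
      rintro (c | d) N
      · exact (hu' c N).continuousOn.mono Set.inter_subset_left
      · exact (hv' d N).continuousOn.mono Set.inter_subset_left)
    (by
      rintro (c | d) z hz
      · exact hul c z hz.1
      · exact hvl d z hz.1)
  have hWU : W ⊆ U := fun z hz => (hWZ hz).1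
  have hweak : ∀ φ : Coord n → ℝ, ContDiff ℝ ∞ φ → HasCompactSupport φ → tsupport φ ⊆ W →
      ∫ x, φ x • P x = 0 := by
    intro φ hφ hc hs
    have hsU := hs.trans hWU
    have hN : ∀ N, ∑ c, -(∫ x, pd (q c) (fun z => φ z * A c z) x * u' c N x)
        + ∑ d, ∫ x, (φ x * B d x) * v' d N x = 0 := fun N => by
      rw [← integral_mul_firstOrder hU hA hB (fun c => hu' c N) (fun d => hv' d N) hφ hc hsU]
      refine integral_eq_zero_of_ae (Eventually.of_forall fun x => ?_)
      by_cases hx : x ∈ tsupport φ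
      · simp [h0 N x (hsU hx)]
      · simp [image_eq_zero_of_notMem_tsupport hx]
    -- All derivatives now fall on the fixed functions `φ A_c`, so pointwise convergence with the
    -- uniform bound on `W` suffices for dominated convergence.
    have hl : Tendsto (fun N => ∑ c, -(∫ x, pd (q c) (fun z => φ z * A c z) x * u' c N x)
        + ∑ d, ∫ x, (φ x * B d x) * v' d N x) atTop
        (𝓝 (∑ c, -(∫ x, pd (q c) (fun z => φ z * A c z) x * u c x)
        + ∑ d, ∫ x, (φ x * B d x) * v d x)) := by
      refine (tendsto_finsetSum _ fun c _ => Tendsto.neg ?_).add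
        (tendsto_finsetSum _ fun d _ => ?_)
      · exact tendsto_integral_mul hWo
          (continuous_pd (contDiff_mul_of_tsupport hU hφ hsU (hA c)) _)
          (hasCompactSupport_pd hc.mul_right _)
          ((tsupport_pd_subset _ _).trans (tsupport_mul_subset_left.trans hs))
          (fun N => (hu' c N).continuousOn.mono hWU) (fun N => hK (Sum.inl c) N)
          (fun z hz => hul c z (hWU hz))
      · exact tendsto_integral_mul hWo
          (continuous_mul_of_tsupport hU hφ.continuous hsU (hB d).continuousOn)
          hc.mul_right (tsupport_mul_subset_left.trans hs)
          (fun N => (hv' d N).continuousOn.mono hWU) (fun N => hK (Sum.inr d) N)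
          (fun z hz => hvl d z (hWU hz))
    simp only [hN] at hl
    simp only [smul_eq_mul]
    rw [integral_mul_firstOrder hU hA hB hu hv hφ hc hsU]
    exact tendsto_nhds_unique hl tendsto_const_nhds
  -- The fundamental lemma of the calculus of variations gives `P = 0` almost everywhere on `W`; as
  -- `P` has no zero on `W`, this set would be null, though it is open and nonempty.
  have hae := hWo.ae_eq_zero_of_integral_contDiff_smul_eq_zero
    ((hPc.mono hWU).locallyIntegrableOn hWo.measurableSet) hweak
  have hW0 : volume W = 0 := by
    rw [← nonpos_iff_eq_zero]
    refine (measure_mono fun z hz => ?_).trans (ae_iff.1 hae).le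
    exact fun h => (hWZ hz).2 (h hz)
  exact (hWo.measure_pos volume hWne).ne' hW0

/-- A smooth pointwise limit of divergence free tensors is divergence free. -/
theorem IsMetricOn.div2_eq_zero_of_tendsto {g : Comp2 n} (hg : IsMetricOn g U) {s : Comp2 n}
    {F : ℕ → Comp2 n} (hs : SmoothMat s U) (hF : ∀ N, SmoothMat (F N) U)
    (hlim : ∀ y ∈ U, ∀ i j, Tendsto (fun N => F N y i j) atTop (𝓝 (s y i j))) {j : Fin n}
    (h0 : ∀ N, ∀ y ∈ U, div2 g (F N) j y = 0) {y : Coord n} (hy : y ∈ U) :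
    div2 g s j y = 0 := by
  -- The derivative terms of the divergence are indexed by pairs `(p, q)`; the zeroth order terms by
  -- two copies of the triples `(p, q, r)`, one for the Christoffel correction of each tensor slot.
  have key : ∀ (t : Comp2 n) (z : Coord n), div2 g t j z
      = firstOrder (C := Fin n × Fin n)
        (D := (Fin n × Fin n × Fin n) ⊕ (Fin n × Fin n × Fin n))
        (fun c x => (g x)⁻¹ c.1 c.2) (fun c => c.2)
        (Sum.elim (fun d x => -((g x)⁻¹ d.1 d.2.1 * christoffel g d.2.2 d.2.1 d.1 x))
          (fun d x => -((g x)⁻¹ d.1 d.2.1 * christoffel g d.2.2 d.2.1 j x)))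
        (fun c x => t x c.1 j)
        (Sum.elim (fun d x => t x d.2.2 j) (fun d x => t x d.1 d.2.2)) z := by
    intro t z
    simp only [div2_eq, covMat_apply, firstOrder, Fintype.sum_sum_type, Sum.elim_inl,
      Sum.elim_inr, Fintype.sum_prod_type, neg_mul, mul_assoc, Finset.sum_neg_distrib,
      mul_sub, Finset.sum_sub_distrib, Finset.mul_sum]
    ring
  rw [key]
  refine firstOrder_eq_zero_of_tendsto hg.isOpen (fun c => hg.smooth_inv _ _) ?_
    (u' := fun c N x => F N x c.1 j)
    (v' := Sum.elim (fun d N x => F N x d.2.2 j) (fun d N x => F N x d.1 d.2.2))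
    (fun c => hs _ _) ?_ (fun c N => hF N _ _) ?_ (fun c z hz => hlim z hz _ _) ?_ ?_ hy
  · rintro (d | d) <;> exact ((hg.smooth_inv _ _).mul (hg.smooth_christoffel _ _ _)).neg
  · rintro (d | d) <;> exact hs _ _
  · rintro (d | d) N <;> exact hF N _ _
  · rintro (d | d) z hz <;> exact hlim z hz _ _
  · intro N z hz
    rw [← h0 N z hz, key]
    congr 1
    funext d
    rcases d with d | d <;> rfl

end Limits

/-! ### Change of frame -/

section Frame

variable {n k : ℕ} {V : Type*} [AddCommGroup V] [Module ℝ V]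

lemma contract_change_frame {G G' Q : Matrix (Fin n) (Fin n) ℝ} (hG : G = Q * G' * Q.transpose)
    {A A' : (Fin k → Fin n) → ℝ} (hA : ∀ I', A' I' = ∑ I, (∏ s, Q (I s) (I' s)) * A I) :
    contract G' A' A' = contract G A A := by
  have h : ∀ I J : Fin k → Fin n, ∏ s, G (I s) (J s) = ∑ I' : Fin k → Fin n,
      ∑ J' : Fin k → Fin n, (∏ s, Q (I s) (I' s)) * (∏ s, G' (I' s) (J' s))
        * ∏ s, Q (J s) (J' s) := by
    intro I J
    have h1 : ∀ a b, G a b = ∑ p, ∑ q, Q a p * G' p q * Q b q := fun a b => by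
      rw [hG, Matrix.mul_apply]
      simp only [Matrix.mul_apply, Matrix.transpose_apply, Finset.sum_mul]
      rw [Finset.sum_comm]
    simp only [h1, Finset.prod_univ_sum, Fintype.piFinset_univ, Finset.prod_mul_distrib]
  calc contract G' A' A'
      = ∑ I' : Fin k → Fin n, ∑ J' : Fin k → Fin n, ∑ I : Fin k → Fin n, ∑ J : Fin k → Fin n,
        (∏ s, G' (I' s) (J' s)) * ((∏ s, Q (I s) (I' s)) * A I)
          * ((∏ s, Q (J s) (J' s)) * A J) := by
        simp only [contract, hA]
        refine Finset.sum_congr rfl fun I' _ => Finset.sum_congr rfl fun J' _ => ?_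
        rw [mul_assoc, Finset.sum_mul_sum, Finset.mul_sum]
        simp only [Finset.mul_sum, mul_assoc]
    _ = _ := sum4_swap _
    _ = contract G A A := by
        simp only [contract, h, Finset.sum_mul]
        exact Finset.sum_congr rfl fun I _ => Finset.sum_congr rfl fun J _ =>
          Finset.sum_congr rfl fun I' _ => Finset.sum_congr rfl fun J' _ => by ring

/-- `|ω|²` computed in a frame. -/
def frameNormSq (B : LinearMap.BilinForm ℝ V) (W : MultilinearMap ℝ (fun _ : Fin k => V) ℝ)
    (v : Fin n → V) : ℝ :=
  contract (Matrix.of fun i j => B (v i) (v j))⁻¹ (fun I => W fun s => v (I s))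
    (fun I => W fun s => v (I s))

/-- The Gram matrix becomes `Qᵀ G Q`, so its inverse transforms contragrediently and cancels the
factors of `Q` in the components of `W`. -/
lemma frameNormSq_basis (B : LinearMap.BilinForm ℝ V)
    (W : MultilinearMap ℝ (fun _ : Fin k => V) ℝ) (v v' : Module.Basis (Fin n) ℝ V) :
    frameNormSq B W v' = frameNormSq B W v := by
  set Q : Matrix (Fin n) (Fin n) ℝ := v.toMatrix v' with hQ
  have hv : ∀ i, v' i = ∑ a, Q a i • v a := fun i => (v.sum_toMatrix_smul_self v' i).symm
  have hgram : (Matrix.of fun i j => B (v' i) (v' j))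
      = Q.transpose * (Matrix.of fun i j => B (v i) (v j)) * Q := by
    ext i j
    simp only [Matrix.of_apply, hv, map_sum, map_smul, LinearMap.sum_apply, LinearMap.smul_apply,
      smul_eq_mul, Matrix.mul_apply, Matrix.transpose_apply, Finset.sum_mul, Finset.mul_sum]
    exact Finset.sum_congr rfl fun a _ => Finset.sum_congr rfl fun b _ => by ring
  have hQ1 : Q * v'.toMatrix v = 1 := v.toMatrix_mul_toMatrix_flip v'
  have hQu : IsUnit Q.det := (Matrix.isUnit_iff_isUnit_det Q).1 (IsUnit.of_mul_eq_one _ hQ1)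
  have hQt : IsUnit Q.transpose.det := by rwa [Matrix.det_transpose]
  refine contract_change_frame (Q := Q) ?_ fun I' => ?_
  · rw [hgram, Matrix.mul_inv_rev, Matrix.mul_inv_rev]
    simp only [Matrix.mul_assoc, Matrix.nonsing_inv_mul _ hQt, Matrix.mul_one]
    rw [← Matrix.mul_assoc, Matrix.mul_nonsing_inv _ hQu, Matrix.one_mul]
  · simp only [hv]
    rw [MultilinearMap.map_sum]
    refine Finset.sum_congr rfl fun I _ => ?_
    rw [MultilinearMap.map_smul_univ, smul_eq_mul]

end Frame

/-! ### Tensor fields in charts -/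

section Charts

variable {n : ℕ} {M : Type*} [TopologicalSpace M] [ChartedSpace (Coord n) M]
  {e e' : OpenPartialHomeomorph M (Coord n)} {y y' : Coord n}

lemma IsChart.mdifferentiable (he : IsChart e) : e.MDifferentiable (𝓡 n) (𝓡 n) :=
  ⟨(contMDiffOn_of_mem_maximalAtlas he).mdifferentiableOn (by simp),
    (contMDiffOn_symm_of_mem_maximalAtlas he).mdifferentiableOn (by simp)⟩

/-- The coordinate vectors of a chart as a basis of the tangent space. -/
def coordBasis (he : IsChart e) (hy : y ∈ e.target) :
    Module.Basis (Fin n) ℝ (TangentSpace (𝓡 n) (e.symm y)) :=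
  (EuclideanSpace.basisFun (Fin n) ℝ).toBasis.map
    (LinearEquiv.ofBijective (mfderiv (𝓡 n) (𝓡 n) e.symm y).toLinearMap
      (he.mdifferentiable.symm.mfderiv_bijective hy))

lemma coordBasis_apply (he : IsChart e) (hy : y ∈ e.target) (i : Fin n) :
    coordBasis he hy i = coordVec e y i :=
  (Module.Basis.map_apply _ _ _).trans <| congrArg (mfderiv (𝓡 n) (𝓡 n) e.symm y) (by simp; rfl)

lemma PseudoRiemannianMetric.isMetricOn (h : PseudoRiemannianMetric n M) (he : IsChart e) :
    IsMetricOn (h.comp e) e.target where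
  isOpen := e.open_target
  symm y := by
    ext i j
    exact h.symm _ _ _
  smooth i j := h.smooth e he i j
  det_ne_zero y hy hdet := by
    -- A kernel vector of the Gram matrix would give a nontrivial combination of coordinate vectors
    -- orthogonal to the whole tangent space.
    obtain ⟨v, hv, h0⟩ := Matrix.exists_mulVec_eq_zero_iff.2 hdet
    have hu : ∑ i, v i • coordBasis he hy i = 0 := by
      refine h.nondegenerate _ _ fun u => ?_
      have : h.toFun (e.symm y) (∑ i, v i • coordBasis he hy i) = 0 := by
        refine (coordBasis he hy).ext fun j => ?_
        have hj := congrFun h0 j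
        simp only [Matrix.mulVec, dotProduct, Pi.zero_apply] at hj
        simp only [map_sum, map_smul, LinearMap.sum_apply, LinearMap.smul_apply, smul_eq_mul,
          LinearMap.zero_apply, coordBasis_apply]
        rw [← hj]
        refine Finset.sum_congr rfl fun i _ => ?_
        rw [mul_comm, h.symm]
        rfl
      rw [this, LinearMap.zero_apply]
    exact hv (funext fun i =>
      Fintype.linearIndependent_iff.1 (coordBasis he hy).linearIndependent v hu i)

lemma SymTwoTensorField.smoothMat (S : SymTwoTensorField n M) (he : IsChart e) :
    SmoothMat (S.comp e) e.target := fun i j => S.smooth e he i j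

lemma SymTensorField.isTraceFreeSymOn {m : ℕ} {h : PseudoRiemannianMetric n M}
    {w : SymTensorField n M (m + 1)} (hw : w.IsTraceFree h) (he : IsChart e) :
    IsTraceFreeSymOn (h.comp e) (w.comp e) e.target where
  smooth I := w.smooth e he I
  symm z σ I := w.symm _ σ fun s => coordVec e z (I s)
  traceZero y hy := by
    cases m with
    | zero => trivial
    | succ r => exact hw e he y hy

/-- The equality of points is a hypothesis because the two bases live in different tangent space
types; substituting it reduces the claim to a change of basis. -/
lemma frameNormSq_eq_of_eq {k : ℕ} (h : PseudoRiemannianMetric n M) (w : SymTensorField n M k)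
    {x x' : M} (hx : x = x') (v : Module.Basis (Fin n) ℝ (TangentSpace (𝓡 n) x))
    (v' : Module.Basis (Fin n) ℝ (TangentSpace (𝓡 n) x')) :
    frameNormSq (h.toFun x) (w.toFun x) v = frameNormSq (h.toFun x') (w.toFun x') v' := by
  subst hx
  exact frameNormSq_basis _ _ _ _

/-- `|ω|²` does not depend on the chart. -/
lemma normSq_comp_eq {k : ℕ} (h : PseudoRiemannianMetric n M) (w : SymTensorField n M k)
    (he : IsChart e) (he' : IsChart e') (hy : y ∈ e.target) (hy' : y' ∈ e'.target)
    (hyy : e.symm y = e'.symm y') :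
    normSq (h.comp e) (w.comp e) y = normSq (h.comp e') (w.comp e') y' := by
  have key : ∀ {f : OpenPartialHomeomorph M (Coord n)} {z : Coord n} (hf : IsChart f)
      (hz : z ∈ f.target), normSq (h.comp f) (w.comp f) z
        = frameNormSq (h.toFun (f.symm z)) (w.toFun (f.symm z)) (coordBasis hf hz) := by
    intro f z hf hz
    simp only [frameNormSq, coordBasis_apply]
    rfl
  rw [key he hy, key he' hy']
  exact frameNormSq_eq_of_eq h w hyy _ _

/-- A function with vanishing derivative in every chart is constant. -/
lemma exists_eq_const_of_pd_eq_zero [IsManifold (𝓡 n) ∞ M] [PreconnectedSpace M] {κ : M → ℝ}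
    (hκ : ∀ e : OpenPartialHomeomorph M (Coord n), IsChart e →
      ContDiffOn ℝ ∞ (fun y => κ (e.symm y)) e.target)
    (h0 : ∀ e : OpenPartialHomeomorph M (Coord n), IsChart e → ∀ y ∈ e.target, ∀ j,
      pd j (fun y => κ (e.symm y)) y = 0) : ∃ c : ℝ, ∀ x, κ x = c := by
  have hloc : IsLocallyConstant κ := by
    refine (IsLocallyConstant.iff_eventually_eq κ).2 fun x => ?_
    set e := chartAt (Coord n) x with he
    have hc : IsChart e := IsManifold.chart_mem_maximalAtlas x
    have hx : x ∈ e.source := mem_chart_source (Coord n) x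
    obtain ⟨r, hr, hrU⟩ := Metric.isOpen_iff.1 e.open_target (e x) (e.map_source hx)
    filter_upwards [e.open_source.mem_nhds hx,
      (e.continuousAt hx).preimage_mem_nhds (Metric.ball_mem_nhds (e x) hr)] with z hz hzb
    have := Metric.isOpen_ball.is_const_of_fderiv_eq_zero (𝕜 := ℝ)
      (convex_ball (e x) r).isPreconnected
      (((hκ e hc).mono hrU).differentiableOn (by simp))
      (fun y hy => fderiv_eq_zero_of_pd fun i => h0 e hc y (hrU hy) i) hzb
      (Metric.mem_ball_self hr)
    simpa only [e.left_inv hz, e.left_inv hx] using this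
  obtain ⟨c, hc⟩ := hloc.exists_eq_const
  exact ⟨c, fun x => congrFun hc x⟩

lemma contDiffOn_comp_symm {κ : M → ℝ} (hκ : ContMDiff (𝓡 n) 𝓘(ℝ, ℝ) ∞ κ) (he : IsChart e) :
    ContDiffOn ℝ ∞ (fun y => κ (e.symm y)) e.target :=
  contMDiffOn_iff_contDiffOn.1
    (hκ.comp_contMDiffOn (contMDiffOn_symm_of_mem_maximalAtlas he))

end Charts

/-! ### Conditionally convergent series -/

section Series

open Filter Topology

variable {f g : ℕ → ℝ} {s t : ℝ}

lemma seriesHasSum_iff :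
    SeriesHasSum f s ↔ Tendsto (fun N => ∑ m ∈ Finset.range N, f m) atTop (𝓝 s) := by
  rw [SeriesHasSum, HasSum, SummationFilter.conditional_filter_eq_map_range, tendsto_map'_iff]
  rfl

lemma SeriesHasSum.seriesSum_eq (hf : SeriesHasSum f s) : seriesSum f = s := HasSum.tsum_eq hf

lemma SeriesHasSum.seriesConverges (hf : SeriesHasSum f s) : SeriesConverges f := ⟨s, hf⟩

lemma SeriesHasSum.add (hf : SeriesHasSum f s) (hg : SeriesHasSum g t) :
    SeriesHasSum (fun m => f m + g m) (s + t) := HasSum.add hf hg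

lemma SeriesHasSum.const_mul (c : ℝ) (hf : SeriesHasSum f s) :
    SeriesHasSum (fun m => c * f m) (c * s) := HasSum.mul_left c hf

lemma SeriesHasSum.congr (hf : SeriesHasSum f s) (h : ∀ m, g m = f m) (hs : t = s) :
    SeriesHasSum g t := by
  rw [funext h, hs]
  exact hf

lemma SeriesHasSum.sum {ι : Type*} (S : Finset ι) {F : ι → ℕ → ℝ} {r : ι → ℝ}
    (hF : ∀ i ∈ S, SeriesHasSum (F i) (r i)) :
    SeriesHasSum (fun m => ∑ i ∈ S, F i m) (∑ i ∈ S, r i) := hasSum_sum hF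

/-- A convergent series multiplied by an antitone null sequence converges. -/
lemma SeriesHasSum.exists_mul_antitone (hf : SeriesHasSum f s) {c : ℕ → ℝ} (hc : Antitone c)
    (hc0 : Tendsto c atTop (𝓝 0)) : ∃ t, SeriesHasSum (fun m => c m * f m) t := by
  rw [seriesHasSum_iff] at hf
  -- Convergent partial sums are bounded, so Dirichlet's test applies.
  obtain ⟨K, hK⟩ := hf.norm.bddAbove_range
  obtain ⟨t, ht⟩ := cauchySeq_tendsto_of_complete
    (hc.cauchySeq_series_mul_of_tendsto_zero_of_bounded hc0 fun N => hK ⟨N, rfl⟩)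
  exact ⟨t, seriesHasSum_iff.2 ht⟩

end Series

/-! ### The stress series at a point -/

section Pointwise

open Filter Topology

variable {n : ℕ} {g : Comp2 n} {y : Coord n} {U : Set (Coord n)}

lemma IsMetricOn.trace2_metric (hg : IsMetricOn g U) (hy : y ∈ U) : trace2 g g y = n := by
  rw [hg.trace2_eq, hg.inv_mul hy, Matrix.trace_one, Fintype.card_fin]

lemma trace2_add_smul (g s : Comp2 n) (c : Coord n → ℝ) (y : Coord n) :
    trace2 g (fun z => s z + c z • g z) y = trace2 g s y + c y * trace2 g g y := by
  simp only [trace2, Matrix.add_apply, Matrix.smul_apply, smul_eq_mul, mul_add,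
    Finset.sum_add_distrib, Finset.mul_sum, mul_left_comm]

lemma SeriesHasSum.trace2 {F : ℕ → Comp2 n} {s : Comp2 n}
    (h : ∀ i j, SeriesHasSum (fun m => F m y i j) (s y i j)) (g : Comp2 n) :
    SeriesHasSum (fun m => trace2 g (F m) y) (trace2 g s y) :=
  SeriesHasSum.sum _ fun i _ => SeriesHasSum.sum _ fun j _ => (h i j).const_mul _

lemma trace2_const_smul (g s : Comp2 n) (c : ℝ) (y : Coord n) :
    trace2 g (fun z => c • s z) y = c * trace2 g s y := by
  simp only [trace2, Matrix.smul_apply, smul_eq_mul, Finset.mul_sum, mul_left_comm]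

/-- If the series of the tensors `T⁺` converges, so do the series of its two parts. -/
lemma IsMetricOn.exists_sum_stressPlus (hg : IsMetricOn g U) (hn : 3 ≤ n) (hy : y ∈ U)
    {w : ∀ m : ℕ, Comp n (m + 1)} (hw : ∀ m, IsTraceFreeSymOn g (w m) U) {a : ℕ → ℝ}
    {S : Comp2 n}
    (hS : ∀ i j, SeriesHasSum (fun m => a m * stressPlus g (w m) y i j) (S y i j)) :
    ∃ A : ℝ, SeriesHasSum (fun m => a m * normSq g (w m) y) A ∧
      (∀ i j, SeriesHasSum (fun m => a m * ricWedge g (w m) y i j)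
        (S y i j + 1 / 2 * A * g y i j)) ∧
      trace2 g S y = (1 - (n : ℝ) / 2) * A := by
  have hn' : (3 : ℝ) ≤ n := by exact_mod_cast hn
  have hc : (1 - (n : ℝ) / 2) ≠ 0 := by linarith
  -- The factor `1 - n/2` is nonzero for `n ≥ 3`, so the traced series determines the series of
  -- norms.
  have ht : ∀ m, trace2 g (fun z => a m • stressPlus g (w m) z) y
      = (1 - (n : ℝ) / 2) * (a m * normSq g (w m) y) := fun m => by
    rw [trace2_const_smul, stressPlus_eq,
      trace2_add_smul g (ricWedge g (w m)) (fun z => -(1 / 2) * normSq g (w m) z),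
      (hw m).trace2_ricWedge hg hy, hg.trace2_metric hy]
    ring
  have h1 := SeriesHasSum.trace2 (F := fun m z => a m • stressPlus g (w m) z) hS g
  have h2 : SeriesHasSum (fun m => a m * normSq g (w m) y)
      ((1 - (n : ℝ) / 2)⁻¹ * trace2 g S y) :=
    (h1.const_mul (1 - (n : ℝ) / 2)⁻¹).congr (fun m => by
      rw [ht, inv_mul_cancel_left₀ hc]) rfl
  refine ⟨_, h2, fun i j => ?_, (mul_inv_cancel_left₀ hc _).symm⟩
  refine ((hS i j).add (h2.const_mul (1 / 2 * g y i j))).congr (fun m => ?_) (by ring)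
  simp only [stressPlus_eq, Matrix.add_apply, Matrix.smul_apply, smul_eq_mul]
  ring

/-- If the series of the tensors `T⁻` converges, so do the series of its parts, also when weighted
by `k⁻¹`. -/
lemma IsMetricOn.exists_sum_stressMinus (hg : IsMetricOn g U) (hy : y ∈ U)
    {w : ∀ m : ℕ, Comp n (m + 1)} (hw : ∀ m, IsTraceFreeSymOn g (w m) U) {b : ℕ → ℝ}
    {T : Comp2 n}
    (hT : ∀ i j, SeriesHasSum (fun m => b m * stressMinus g (w m) y i j) (T y i j)) :
    ∃ B B' : ℝ, SeriesHasSum (fun m => b m * normSq g (w m) y) B ∧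
      SeriesHasSum (fun m => 1 / ((m : ℝ) + 1) * (b m * normSq g (w m) y)) B' ∧
      (∀ i j, SeriesHasSum (fun m => b m * ricWedge g (w m) y i j)
        (T y i j - 1 / 2 * B' * g y i j)) ∧
      trace2 g T y = B + (n : ℝ) / 2 * B' := by
  have ht : ∀ m : ℕ, trace2 g (fun z => b m • stressMinus g (w m) z) y
      = ((n : ℝ) + 2 * ((m : ℝ) + 1)) / (2 * ((m : ℝ) + 1)) * (b m * normSq g (w m) y) :=
    fun m => by
      have hm : ((m : ℝ) + 1) ≠ 0 := by positivity
      rw [trace2_const_smul, stressMinus_eq, trace2_add_smul g (ricWedge g (w m))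
        (fun z => 1 / (2 * ((m : ℝ) + 1)) * normSq g (w m) z),
        (hw m).trace2_ricWedge hg hy, hg.trace2_metric hy]
      field_simp
      ring
  have h1 := SeriesHasSum.trace2 (F := fun m z => b m • stressMinus g (w m) z) hT g
  simp only [ht] at h1
  -- With `k = m + 1`, multiplying the coefficient `(n+2k)/(2k)` by `2/(n+2k)` leaves `1/k`.
  -- Convergence may be conditional, hence the need for monotone weights.
  have hanti : Antitone fun m : ℕ => 2 / ((n : ℝ) + 2 * ((m : ℝ) + 1)) := by
    intro p q hpq
    have : (p : ℝ) ≤ q := by exact_mod_cast hpq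
    simp only
    gcongr
  have hnull : Tendsto (fun m : ℕ => 2 / ((n : ℝ) + 2 * ((m : ℝ) + 1))) atTop (𝓝 0) := by
    refine Tendsto.div_atTop tendsto_const_nhds
      (tendsto_atTop_mono (fun m : ℕ => ?_) tendsto_natCast_atTop_atTop)
    have : (0 : ℝ) ≤ n := by positivity
    have : (0 : ℝ) ≤ m := by positivity
    linarith
  obtain ⟨B', hB'⟩ := h1.exists_mul_antitone hanti hnull
  have h2 : SeriesHasSum (fun m => 1 / ((m : ℝ) + 1) * (b m * normSq g (w m) y)) B' :=
    hB'.congr (fun m => by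
      have hm : ((m : ℝ) + 1) ≠ 0 := by positivity
      have hm' : (n : ℝ) + 2 * ((m : ℝ) + 1) ≠ 0 := by positivity
      field_simp) rfl
  -- Since `(n+2k)/(2k) = 1 + (n/2)(1/k)`, subtracting `n/2` times the weighted series isolates the
  -- unweighted one.
  have h3 : SeriesHasSum (fun m => b m * normSq g (w m) y)
      (trace2 g T y + -((n : ℝ) / 2) * B') :=
    (h1.add (h2.const_mul (-((n : ℝ) / 2)))).congr (fun m => by
      have hm : ((m : ℝ) + 1) ≠ 0 := by positivity
      field_simp
      ring) rfl
  refine ⟨_, B', h3, h2, fun i j => ?_, by ring⟩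
  refine ((hT i j).add (h2.const_mul (-(1 / 2) * g y i j))).congr (fun m => ?_) (by ring)
  have hm : ((m : ℝ) + 1) ≠ 0 := by positivity
  simp only [stressMinus_eq, Matrix.add_apply, Matrix.smul_apply, smul_eq_mul]
  field_simp
  ring

lemma trace2_congr {s t : Comp2 n} (h : s y = t y) : trace2 g s y = trace2 g t y := by
  simp only [trace2, h]

/-- The trace of the Einstein equations. -/
lemma IsMetricOn.einstein_trace (hg : IsMetricOn g U) (hn : 3 ≤ n) (hy : y ∈ U) {S T : Comp2 n}
    {κ : Coord n → ℝ} (hE : einsteinTensor g κ y = S y + T y) :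
    κ y = scal g y + 2 / ((n : ℝ) - 2) * (trace2 g S y + trace2 g T y) := by
  have hn' : (3 : ℝ) ≤ n := by exact_mod_cast hn
  have hn0 : (n : ℝ) ≠ 0 := by linarith
  have hn2 : (n : ℝ) - 2 ≠ 0 := by linarith
  have h1 : trace2 g (einsteinTensor g κ) y = trace2 g S y + trace2 g T y := by
    rw [trace2_congr (t := fun z => S z + T z) hE]
    simp only [trace2, Matrix.add_apply, mul_add, Finset.sum_add_distrib]
  have h2 : einsteinTensor g κ = fun z => ricci g z
      + (-(1 / 2) * scal g z + ((n : ℝ) - 2) / (2 * (n : ℝ)) * κ z) • g z := by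
    funext z
    simp only [einsteinTensor, add_smul, neg_mul, neg_smul]
    abel
  have h3 : trace2 g (ricci g) y = scal g y := rfl
  rw [h2, trace2_add_smul g (ricci g) (fun z => -(1 / 2) * scal g z
    + ((n : ℝ) - 2) / (2 * (n : ℝ)) * κ z), hg.trace2_metric hy, h3] at h1
  rw [← h1]
  field_simp
  ring

/-- The Einstein equations at a point amount to a Ricci condition. -/
lemma IsMetricOn.einstein_iff (hg : IsMetricOn g U) (hn : 3 ≤ n) (hy : y ∈ U) {S T : Comp2 n}
    {κ : Coord n → ℝ} {A B B' : ℝ} (hS : trace2 g S y = (1 - (n : ℝ) / 2) * A)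
    (hT : trace2 g T y = B + (n : ℝ) / 2 * B') :
    einsteinTensor g κ y = S y + T y ↔ ∀ i j, ricci g y i j
      - (S y i j + 1 / 2 * A * g y i j) - (T y i j - 1 / 2 * B' * g y i j)
      = (κ y / (n : ℝ) - 1 / ((n : ℝ) - 2) * (B + B')) * g y i j := by
  have hn' : (3 : ℝ) ≤ n := by exact_mod_cast hn
  have hn0 : (n : ℝ) ≠ 0 := by linarith
  have hn2 : (n : ℝ) - 2 ≠ 0 := by linarith
  have hE : einsteinTensor g κ y = S y + T y ↔ ∀ i j, ricci g y i j - 1 / 2 * scal g y * g y i j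
      + ((n : ℝ) - 2) / (2 * (n : ℝ)) * κ y * g y i j = S y i j + T y i j := Matrix.ext_iff.symm
  -- Under the trace formula for `κ` the pure-trace terms of the two forms of the equations agree;
  -- each direction derives this formula from the trace of its own hypothesis.
  have key : κ y = scal g y - A + ((n : ℝ) * B' + 2 * B) / ((n : ℝ) - 2) →
      1 / 2 * scal g y - ((n : ℝ) - 2) / (2 * (n : ℝ)) * κ y - 1 / 2 * A + 1 / 2 * B'
        = κ y / (n : ℝ) - 1 / ((n : ℝ) - 2) * (B + B') := fun h => by
    rw [h]
    field_simp
    ring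
  constructor
  · intro h i j
    have hκ := hg.einstein_trace hn hy h
    have hκ' : κ y = scal g y - A + ((n : ℝ) * B' + 2 * B) / ((n : ℝ) - 2) := by
      rw [hκ, hS, hT]
      field_simp
      ring
    rw [← key hκ']
    linear_combination hE.1 h i j
  · intro h
    have htr : ∑ i, ∑ j, (g y)⁻¹ i j * (ricci g y i j
        - (S y i j + 1 / 2 * A * g y i j) - (T y i j - 1 / 2 * B' * g y i j))
        = ∑ i, ∑ j, (g y)⁻¹ i j *
          ((κ y / (n : ℝ) - 1 / ((n : ℝ) - 2) * (B + B')) * g y i j) := by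
      simp only [h]
    have hg1 := hg.trace2_metric hy
    have hR : trace2 g (ricci g) y = scal g y := rfl
    simp only [trace2] at hg1 hR hS hT
    simp only [mul_sub, mul_add, Finset.sum_sub_distrib, Finset.sum_add_distrib,
      mul_left_comm _ (_ * _ : ℝ), mul_left_comm _ (_ - _ : ℝ), ← Finset.mul_sum, hg1, hR, hS,
      hT] at htr
    have hκ' : κ y = scal g y - A + ((n : ℝ) * B' + 2 * B) / ((n : ℝ) - 2) := by
      field_simp at htr ⊢
      linarith
    refine hE.2 fun i j => ?_
    have := h i j
    rw [← key hκ'] at this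
    linear_combination this

end Pointwise

/-! ### Divergence free limits on the manifold -/

section Global

open Filter Topology

variable {n : ℕ} {M : Type*} [TopologicalSpace M] [ChartedSpace (Coord n) M]
  {h : PseudoRiemannianMetric n M}

/-- The partial sums are smooth and divergence free by linearity, and the limit is smooth by
assumption. The construction `t` stands for either `stressPlus` or `stressMinus`. -/
lemma isDivFree_of_series {t : ∀ {m : ℕ}, Comp2 n → Comp n (m + 1) → Comp2 n}
    (v : ∀ m : ℕ, SymTensorField n M (m + 1)) (a : ℕ → ℝ) (S : SymTwoTensorField n M)
    (ht : ∀ e : OpenPartialHomeomorph M (Coord n), IsChart e → ∀ m,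
      SmoothMat (t (h.comp e) ((v m).comp e)) e.target)
    (h0 : ∀ e : OpenPartialHomeomorph M (Coord n), IsChart e → ∀ y ∈ e.target, ∀ m j,
      div2 (h.comp e) (t (h.comp e) ((v m).comp e)) j y = 0)
    (hS : ∀ e : OpenPartialHomeomorph M (Coord n), IsChart e → ∀ y ∈ e.target, ∀ i j,
      SeriesHasSum (fun m => a m * t (h.comp e) ((v m).comp e) y i j) (S.comp e y i j)) :
    S.IsDivFree h := by
  intro e he y hy j
  have hg := h.isMetricOn he
  set F : ℕ → Comp2 n := fun N z => Matrix.of fun i j =>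
    ∑ m ∈ Finset.range N, a m * t (h.comp e) ((v m).comp e) z i j with hF
  have hFs : ∀ N, SmoothMat (F N) e.target := fun N i j =>
    ContDiffOn.sum (s := Finset.range N)
      (f := fun m z => a m * t (h.comp e) ((v m).comp e) z i j)
      fun m _ => contDiffOn_const.mul (ht e he m i j)
  refine hg.div2_eq_zero_of_tendsto (S.smoothMat he) hFs
    (fun z hz i j => seriesHasSum_iff.1 (hS e he z hz i j)) (fun N => ?_) hy
  induction N with
  | zero =>
    intro z hz
    -- The empty sum is written as a zero multiple of the metric so that `div2_smul_metric` applies.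
    have : F 0 = fun z => (0 : ℝ) • h.comp e z := by
      funext z
      ext i j
      simp [hF]
    rw [this, hg.div2_smul_metric contDiffOn_const hz, pd_const]
  | succ N ih =>
    intro z hz
    have hs : F (N + 1) = fun z => F N z + a N • t (h.comp e) ((v N).comp e) z := by
      funext z
      ext i j
      simp only [hF, Matrix.of_apply, Matrix.add_apply, Matrix.smul_apply, smul_eq_mul,
        Finset.sum_range_succ]
    have hsm : ∀ q, covMat (h.comp e) q (fun z => a N • t (h.comp e) ((v N).comp e) z) z
        = a N • covMat (h.comp e) q (t (h.comp e) ((v N).comp e)) z := fun q => by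
      rw [covMat_smul hg.isOpen contDiffOn_const (ht e he N) hz, pd_const, zero_smul, zero_add]
    have hd : div2 (h.comp e) (fun z => a N • t (h.comp e) ((v N).comp e) z) j z
        = a N * div2 (h.comp e) (t (h.comp e) ((v N).comp e)) j z := by
      simp only [div2_eq, hsm, Matrix.smul_apply, smul_eq_mul, Finset.mul_sum, mul_left_comm]
    rw [hs, div2_add hg.isOpen (hFs N) ((ht e he N).smul contDiffOn_const) hz, ih z hz, hd,
      h0 e he z hz, mul_zero, add_zero]

lemma div2_add_eq_zero {S T : SymTwoTensorField n M} (hS : S.IsDivFree h) (hT : T.IsDivFree h)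
    {e : OpenPartialHomeomorph M (Coord n)} (he : IsChart e) {y : Coord n} (hy : y ∈ e.target)
    (j : Fin n) : div2 (h.comp e) (fun z => S.comp e z + T.comp e z) j y = 0 := by
  rw [div2_add e.open_target (S.smoothMat he) (T.smoothMat he) hy, hS e he y hy, hT e he y hy,
    add_zero]

/-- Smoothness of `κ` is asked only in the given chart, so this also serves when it is known merely
from the trace of the equations. -/
lemma pd_eq_zero_of_compatible (hn : 3 ≤ n) {S T : SymTwoTensorField n M}
    (hS : S.IsDivFree h) (hT : T.IsDivFree h) {κ : M → ℝ}
    {e : OpenPartialHomeomorph M (Coord n)} (he : IsChart e)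
    (hκ : ContDiffOn ℝ ∞ (fun y => κ (e.symm y)) e.target) {y : Coord n} (hy : y ∈ e.target)
    (j : Fin n) (hd : div2 (h.comp e) (einsteinTensor (h.comp e) fun z => κ (e.symm z)) j y
      = div2 (h.comp e) (fun z => S.comp e z + T.comp e z) j y) :
    pd j (fun y => κ (e.symm y)) y = 0 := by
  have hn' : (3 : ℝ) ≤ n := by exact_mod_cast hn
  rw [div2_add_eq_zero hS hT he hy, (h.isMetricOn he).div2_einsteinTensor hκ hy] at hd
  refine (mul_eq_zero.1 hd).resolve_left (div_ne_zero ?_ ?_) <;> linarith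

lemma einsteinDivergenceCompatible_iff [IsManifold (𝓡 n) ∞ M] [ConnectedSpace M] (hn : 3 ≤ n)
    {S T : SymTwoTensorField n M} (hS : S.IsDivFree h) (hT : T.IsDivFree h) {κ : M → ℝ}
    (hκ : ContMDiff (𝓡 n) 𝓘(ℝ, ℝ) ∞ κ) :
    EinsteinDivergenceCompatible h S T κ ↔ ∃ c : ℝ, ∀ x, κ x = c := by
  constructor
  · intro hd
    exact exists_eq_const_of_pd_eq_zero (fun e he => contDiffOn_comp_symm hκ he)
      fun e he y hy j => pd_eq_zero_of_compatible hn hS hT he (contDiffOn_comp_symm hκ he) hy j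
        (hd e he y hy j)
  · rintro ⟨c, hc⟩ e he y hy j
    rw [(h.isMetricOn he).div2_einsteinTensor (contDiffOn_comp_symm hκ he) hy,
      div2_add_eq_zero hS hT he hy]
    simp only [hc, pd_const, mul_zero]

/-- No regularity of `κ` is assumed: the trace of the equations writes it through `R`, `tr S` and
`tr T`, which are smooth. -/
lemma SolvesEinstein.exists_eq_const [IsManifold (𝓡 n) ∞ M] [ConnectedSpace M] (hn : 3 ≤ n)
    {S T : SymTwoTensorField n M} (hS : S.IsDivFree h) (hT : T.IsDivFree h) {κ : M → ℝ}
    (hE : SolvesEinstein h S T κ) : ∃ c : ℝ, ∀ x, κ x = c := by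
  have hκ : ∀ e : OpenPartialHomeomorph M (Coord n), IsChart e →
      ContDiffOn ℝ ∞ (fun y => κ (e.symm y)) e.target := by
    intro e he
    have hg := h.isMetricOn he
    refine ContDiffOn.congr ?_ fun y hy => hg.einstein_trace hn hy (hE e he y hy)
    exact hg.smooth_scal.add (contDiffOn_const.mul
      ((hg.smooth_trace2 (S.smoothMat he)).add (hg.smooth_trace2 (T.smoothMat he))))
  exact exists_eq_const_of_pd_eq_zero hκ fun e he y hy j =>
    pd_eq_zero_of_compatible hn hS hT he (hκ e he) hy j
      (div2_congr e.open_target hy (fun z hz => hE e he z hz) j)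

end Global

end

end CoupledEinstein

/-- The tensors of rank `k ≥ 1` and their coefficients are indexed by `m = k - 1`. -/
theorem mainTheorem8 {n : ℕ} (hn : 3 ≤ n) {M : Type*} [TopologicalSpace M]
    [ChartedSpace (EuclideanSpace ℝ (Fin n)) M] [IsManifold (𝓡 n) ∞ M] [ConnectedSpace M]
    (h : PseudoRiemannianMetric n M)
    (w γ : ∀ m : ℕ, SymTensorField n M (m + 1)) (a b : ℕ → ℝ)
    (hw_tf : ∀ m, (w m).IsTraceFree h)
    (hw_div : ∀ m, (w m).DivPairingZero h)
    (hw_cod : ∀ m, (w m).CodazziPairingZero h)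
    (hγ_tf : ∀ m, (γ m).IsTraceFree h)
    (hγ_div : ∀ m, (γ m).DivPairingZero h)
    (hγ_kil : ∀ m, (γ m).ConfKillingPairingZero h)
    (S T : SymTwoTensorField n M)
    (hS : ∀ e : OpenPartialHomeomorph M (EuclideanSpace ℝ (Fin n)), IsChart e →
      ∀ y ∈ e.target, ∀ i j,
        SeriesHasSum (fun m => a m * stressPlus (h.comp e) ((w m).comp e) y i j)
          (S.comp e y i j))
    (hT : ∀ e : OpenPartialHomeomorph M (EuclideanSpace ℝ (Fin n)), IsChart e →
      ∀ y ∈ e.target, ∀ i j,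
        SeriesHasSum (fun m => b m * stressMinus (h.comp e) ((γ m).comp e) y i j)
          (T.comp e y i j)) :
    -- the stress tensors are divergence free
    S.IsDivFree h ∧ T.IsDivFree h ∧
    -- consistency: the divergence of the Einstein equations holds exactly when `κ` is constant
    (∀ κ : M → ℝ, ContMDiff (𝓡 n) 𝓘(ℝ, ℝ) ∞ κ →
      (EinsteinDivergenceCompatible h S T κ ↔ ∃ c : ℝ, ∀ x, κ x = c)) ∧
    -- all the series below converge pointwise
    (∀ e : OpenPartialHomeomorph M (EuclideanSpace ℝ (Fin n)), IsChart e → ∀ y ∈ e.target,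
      SeriesConverges (fun m => a m * normSq (h.comp e) ((w m).comp e) y) ∧
      SeriesConverges (fun m => ((n : ℝ) + 2 * ((m : ℝ) + 1)) / (((m : ℝ) + 1) * ((n : ℝ) - 2)) *
        b m * normSq (h.comp e) ((γ m).comp e) y) ∧
      SeriesConverges (fun m => (((m : ℝ) + 1) + 1) / ((m : ℝ) + 1) *
        b m * normSq (h.comp e) ((γ m).comp e) y) ∧
      ∀ i j,
        SeriesConverges (fun m => a m * ricWedge (h.comp e) ((w m).comp e) y i j) ∧
        SeriesConverges (fun m => b m * ricWedge (h.comp e) ((γ m).comp e) y i j)) ∧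
    -- a function `κ` in a solution is constant and is given by the trace formula
    (∀ κ : M → ℝ, SolvesEinstein h S T κ →
      (∃ c : ℝ, ∀ x, κ x = c) ∧
      ∀ e : OpenPartialHomeomorph M (EuclideanSpace ℝ (Fin n)), IsChart e → ∀ y ∈ e.target,
        κ (e.symm y) = scal (h.comp e) y
          - seriesSum (fun m => a m * normSq (h.comp e) ((w m).comp e) y)
          + seriesSum (fun m =>
              ((n : ℝ) + 2 * ((m : ℝ) + 1)) / (((m : ℝ) + 1) * ((n : ℝ) - 2)) *
                b m * normSq (h.comp e) ((γ m).comp e) y)) ∧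
    -- the Einstein equations with `κ` amount to the Ricci condition with the same `κ`
    (∀ κ : M → ℝ, SolvesEinstein h S T κ ↔
      ∀ e : OpenPartialHomeomorph M (EuclideanSpace ℝ (Fin n)), IsChart e → ∀ y ∈ e.target,
        ∀ i j, reducedRicci h w γ a b e y i j =
          (κ (e.symm y) / (n : ℝ)
            - 1 / ((n : ℝ) - 2) * seriesSum (fun m => (((m : ℝ) + 1) + 1) / ((m : ℝ) + 1) *
                b m * normSq (h.comp e) ((γ m).comp e) y)) * h.comp e y i j) ∧
    -- they hold for some real constant exactly when the Ricci condition holds up to pure trace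
    ((∃ c : ℝ, SolvesEinstein h S T (fun _ => c)) ↔
      ∃ μ : M → ℝ, ∀ e : OpenPartialHomeomorph M (EuclideanSpace ℝ (Fin n)), IsChart e →
        ∀ y ∈ e.target, ∀ i j,
          reducedRicci h w γ a b e y i j = μ (e.symm y) * h.comp e y i j) := by
  have hdS : S.IsDivFree h := isDivFree_of_series (t := fun g v => stressPlus g v) w a S
    (fun e he m => by
      rw [stressPlus_eq]
      exact (SymTensorField.isTraceFreeSymOn (hw_tf m) he).smooth_ricWedge_add
        (h.isMetricOn he) _)
    (fun e he y hy m j => (SymTensorField.isTraceFreeSymOn (hw_tf m) he).div2_stressPlus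
      (h.isMetricOn he) hy j (hw_div m e he y hy j) (hw_cod m e he y hy j)) hS
  have hdT : T.IsDivFree h := isDivFree_of_series (t := fun g v => stressMinus g v) γ b T
    (fun e he m => (SymTensorField.isTraceFreeSymOn (hγ_tf m) he).smooth_ricWedge_add
        (h.isMetricOn he) _)
    (fun e he y hy m j => (SymTensorField.isTraceFreeSymOn (hγ_tf m) he).div2_stressMinus
      (h.isMetricOn he) hy j (hγ_div m e he y hy j) (hγ_kil m e he y hy j)) hT
  have hn' : (3 : ℝ) ≤ n := by exact_mod_cast hn
  have hn0 : (n : ℝ) ≠ 0 := by linarith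
  have hn2 : (n : ℝ) - 2 ≠ 0 := by linarith
  have hsum : ∀ e : OpenPartialHomeomorph M (EuclideanSpace ℝ (Fin n)), IsChart e →
      ∀ y ∈ e.target, ∃ A B B' : ℝ,
      SeriesHasSum (fun m => a m * normSq (h.comp e) ((w m).comp e) y) A ∧
      SeriesHasSum (fun m => ((n : ℝ) + 2 * ((m : ℝ) + 1)) / (((m : ℝ) + 1) * ((n : ℝ) - 2)) *
        b m * normSq (h.comp e) ((γ m).comp e) y) (((n : ℝ) * B' + 2 * B) / ((n : ℝ) - 2)) ∧
      SeriesHasSum (fun m => (((m : ℝ) + 1) + 1) / ((m : ℝ) + 1) *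
        b m * normSq (h.comp e) ((γ m).comp e) y) (B + B') ∧
      (∀ i j, SeriesHasSum (fun m => a m * ricWedge (h.comp e) ((w m).comp e) y i j)
        (S.comp e y i j + 1 / 2 * A * h.comp e y i j)) ∧
      (∀ i j, SeriesHasSum (fun m => b m * ricWedge (h.comp e) ((γ m).comp e) y i j)
        (T.comp e y i j - 1 / 2 * B' * h.comp e y i j)) ∧
      trace2 (h.comp e) (S.comp e) y = (1 - (n : ℝ) / 2) * A ∧
      trace2 (h.comp e) (T.comp e) y = B + (n : ℝ) / 2 * B' := by
    intro e he y hy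
    obtain ⟨A, hA, hAr, hAt⟩ := (h.isMetricOn he).exists_sum_stressPlus hn hy
      (fun m => SymTensorField.isTraceFreeSymOn (hw_tf m) he) (hS e he y hy)
    obtain ⟨B, B', hB, hB', hBr, hBt⟩ := (h.isMetricOn he).exists_sum_stressMinus hy
      (fun m => SymTensorField.isTraceFreeSymOn (hγ_tf m) he) (hT e he y hy)
    refine ⟨A, B, B', hA, ?_, ?_, hAr, hBr, hAt, hBt⟩
    -- With `k = m + 1`, `(n+2k)/(k(n-2)) = (n/(n-2))(1/k) + 2/(n-2)`; the next series uses `(k+1)/k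
    -- = 1 + 1/k`.
    · refine ((hB'.const_mul ((n : ℝ) / ((n : ℝ) - 2))).add
        (hB.const_mul (2 / ((n : ℝ) - 2)))).congr (fun m => ?_) ?_
      · have hm : ((m : ℝ) + 1) ≠ 0 := by positivity
        field_simp
      · field_simp
    · refine (hB.add hB').congr (fun m => ?_) rfl
      have hm : ((m : ℝ) + 1) ≠ 0 := by positivity
      field_simp
  have hiff : ∀ κ : M → ℝ, SolvesEinstein h S T κ ↔
      ∀ e : OpenPartialHomeomorph M (EuclideanSpace ℝ (Fin n)), IsChart e → ∀ y ∈ e.target,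
        ∀ i j, reducedRicci h w γ a b e y i j =
          (κ (e.symm y) / (n : ℝ)
            - 1 / ((n : ℝ) - 2) * seriesSum (fun m => (((m : ℝ) + 1) + 1) / ((m : ℝ) + 1) *
                b m * normSq (h.comp e) ((γ m).comp e) y)) * h.comp e y i j := by
    intro κ
    refine forall_congr' fun e => forall_congr' fun he => forall_congr' fun y =>
      forall_congr' fun hy => ?_
    obtain ⟨A, B, B', -, -, hBB, hAr, hBr, hAt, hBt⟩ := hsum e he y hy
    rw [(h.isMetricOn he).einstein_iff hn hy hAt hBt, hBB.seriesSum_eq]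
    refine forall_congr' fun i => forall_congr' fun j => ?_
    rw [reducedRicci, (hAr i j).seriesSum_eq, (hBr i j).seriesSum_eq]
  refine ⟨hdS, hdT, fun κ hκ => einsteinDivergenceCompatible_iff hn hdS hdT hκ,
    fun e he y hy => ?_, fun κ hE => ⟨hE.exists_eq_const hn hdS hdT, fun e he y hy => ?_⟩, hiff, ?_⟩
  · obtain ⟨A, B, B', hA, hBn, hBB, hAr, hBr, -, -⟩ := hsum e he y hy
    exact ⟨hA.seriesConverges, hBn.seriesConverges, hBB.seriesConverges, fun i j =>
      ⟨(hAr i j).seriesConverges, (hBr i j).seriesConverges⟩⟩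
  · obtain ⟨A, B, B', hA, hBn, -, -, -, hAt, hBt⟩ := hsum e he y hy
    have hκ := (h.isMetricOn he).einstein_trace hn hy (κ := fun z => κ (e.symm z))
      (hE e he y hy)
    rw [hA.seriesSum_eq, hBn.seriesSum_eq, hκ, hAt, hBt]
    field_simp
    ring
  -- The series is evaluated at each point in the preferred chart there, which makes it a function
  -- on `M`; `hβe` checks that any other chart gives the same value.
  · set β : M → ℝ := fun x => seriesSum fun m => (((m : ℝ) + 1) + 1) / ((m : ℝ) + 1) * b m *
      normSq (h.comp (chartAt (EuclideanSpace ℝ (Fin n)) x))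
        ((γ m).comp (chartAt (EuclideanSpace ℝ (Fin n)) x))
        (chartAt (EuclideanSpace ℝ (Fin n)) x x) with hβ
    have hβe : ∀ e : OpenPartialHomeomorph M (EuclideanSpace ℝ (Fin n)), IsChart e →
        ∀ y ∈ e.target, seriesSum (fun m => (((m : ℝ) + 1) + 1) / ((m : ℝ) + 1) *
          b m * normSq (h.comp e) ((γ m).comp e) y) = β (e.symm y) := by
      intro e he y hy
      simp only [hβ]
      congr 1
      funext m
      congr 1
      have hx := mem_chart_source (EuclideanSpace ℝ (Fin n)) (e.symm y)
      exact normSq_comp_eq h (γ m) he (IsManifold.chart_mem_maximalAtlas _) hy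
        (OpenPartialHomeomorph.map_source _ hx) (OpenPartialHomeomorph.left_inv _ hx).symm
    constructor
    · rintro ⟨c, hE⟩
      refine ⟨fun x => c / (n : ℝ) - 1 / ((n : ℝ) - 2) * β x, fun e he y hy i j => ?_⟩
      rw [(hiff _).1 hE e he y hy i j, hβe e he y hy]
    · rintro ⟨μ, hμ⟩
      -- The function is found by solving `μ = κ/n - β/(n-2)` for `κ`. It solves the Einstein
      -- equations, and this forces it to be constant.
      have hE : SolvesEinstein h S T fun x => n * (μ x + 1 / ((n : ℝ) - 2) * β x) := by
        refine (hiff _).2 fun e he y hy i j => ?_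
        rw [hμ e he y hy i j, hβe e he y hy, mul_div_cancel_left₀ _ hn0, add_sub_cancel_right]
      obtain ⟨c, hc⟩ := hE.exists_eq_const hn hdS hdT
      exact ⟨c, by rwa [funext hc] at hE⟩
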